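/- Let $(X,d)$ be a complete separable metric space with its Borel $\sigma$-algebra, and let $m=(m_x)_{x\in X}$ be a random walk on $X$: a measurable family of probability measures, each with finite first moment. For $x\neq y$ let $\kappa(x,y):=1-\mathcal T_1(m_x,m_y)/d(x,y)$ be the Ricci curvature, where $\mathcal T_1$ is the $L^1$ transportation distance, and suppose that $\kappa(x,y)\ge\kappa>0$ for all $x\ne y$. Let $\nu$ be the invariant probability distribution of the random walk. Put $$\sigma(x)^2:=\tfrac12\iint d(y,z)^2\,dm_x(y)\,dm_x(z),\qquad n_x:=\frac{\sigma(x)^2}{\sup\{\mathrm{Var}_{m_x}f:\ f\ 1\text{-Lipschitz}\}},\qquad \sigma_\infty:=\sup_x\tfrac12\,\mathrm{diam}\,\mathrm{Supp}\,m_x$$ (with the convention $\sigma(x)^2/n_x=0$ if $\sigma(x)=0$). For all $x,y$ choose a coupling $\xi_{x,y}$ of $m_x$ and $m_y$ realizing $\mathcal T_1(m_x,m_y)$, and let $$\kappa_-(x,y):=\frac1{d(x,y)}\int \big(d(x,y)-d(a,b)\big)_-\,d\xi_{x,y}(a,b),\qquad U:=\sup_{x\ne y}\frac{\kappa_-(x,y)}{\kappa(x,y)},$$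 where $a_-=\max(-a,0)$. Let $0<\lambda\le\frac{1}{24\,\sigma_\infty(1+U)}$ and, for $f:X\to\mathbb R$, let $$Df(x):=\sup_{y\ne y'}\frac{|f(y)-f(y')|}{d(y,y')}\,e^{-\lambda d(x,y)-\lambda d(x,y')}.$$ Then for every $f:X\to\mathbb R$ with $Df<\infty$ everywhere, $$\mathrm{Var}_\nu f\le\Big(\sup_x\frac{4\sigma(x)^2}{\kappa n_x}\Big)\int (Df)^2\,d\nu,$$ and if $f$ is positive, $$\mathrm{Ent}_\nu f\le\Big(\sup_x\frac{4\sigma(x)^2}{\kappa n_x}\Big)\int\frac{(Df)^2}{f}\,d\nu,$$ where $\mathrm{Ent}_\nu f:=\int f\log f\,d\nu-\int f\,d\nu\,\log\int f\,d\nu$. If moreover the random walk is reversible with respect to $\nu$, then $$\mathrm{Var}_\nu f\le\int V(x)\,Df(x)^2\,d\nu(x)\qquad\text{and, if $f$ is positive,}\qquad \mathrm{Ent}_\nu f\le\int V(x)\,\frac{Df(x)^2}{f(x)}\,d\nu(x),$$ where $$V(x):=2\sum_{t=0}^\infty(1-\kappa/2)^{2t}\,M^{t+1}\Big(\frac{\sigma^2}{n}\Big)(x),\qquad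 Mg(x):=\int g\,dm_x.$$ All quantities take values in $[0,\infty]$: $\mathrm{Var}_\nu f=\infty$ if $f\notin L^2(\nu)$, and $\mathrm{Ent}_\nu f=\infty$ unless $f$ and $f\log f$ are $\nu$-integrable; so finiteness of a right-hand side implies these integrability properties. -/

import Mathlib

open MeasureTheory ProbabilityTheory
open scoped ENNReal NNReal

noncomputable section

/-- `ξ` is a coupling of `μ` and `μ'`: its two marginals are `μ` and `μ'`. -/
def IsCoupling {X : Type*} [MeasurableSpace X] (ξ : Measure (X × X)) (μ μ' : Measure X) : Prop :=
  ξ.map Prod.fst = μ ∧ ξ.map Prod.snd = μ'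

/-- The `L¹` transport cost `∫ d(a, b) dξ(a, b)` of `ξ`. -/
def transportCost {X : Type*} [MetricSpace X] [MeasurableSpace X] (ξ : Measure (X × X)) : ℝ≥0∞ :=
  ∫⁻ p, edist p.1 p.2 ∂ξ

/-- The `L¹` transportation distance. -/
def transportDist {X : Type*} [MetricSpace X] [MeasurableSpace X] (μ μ' : Measure X) : ℝ≥0∞ :=
  ⨅ (ξ : Measure (X × X)) (_ : IsCoupling ξ μ μ'), transportCost ξ

/-- `ξ` is an optimal coupling of `μ` and `μ'`: it attains the transportation distance. -/
def IsOptimalCoupling {X : Type*} [MetricSpace X] [MeasurableSpace X]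
    (ξ : Measure (X × X)) (μ μ' : Measure X) : Prop :=
  IsCoupling ξ μ μ' ∧ transportCost ξ = transportDist μ μ'

/-- A random walk on `X`: a Markov kernel (a measurable family of probability measures `m x`)
such that every `m x` has finite first moment. -/
structure IsRandomWalk {X : Type*} [MetricSpace X] [MeasurableSpace X] (m : Kernel X X) :
    Prop where
  isMarkovKernel : IsMarkovKernel m
  finite_first_moment : ∀ x, ∃ o, ∫⁻ y, edist o y ∂(m x) < ∞

/-- The (coarse) Ricci curvature `κ(x, y) = 1 - T₁(m_x, m_y) / d(x, y)` in the direction `(x, y)`,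
meaningful for `x ≠ y`. The transportation distance is finite for random walks. -/
def ricciCurv {X : Type*} [MetricSpace X] [MeasurableSpace X] (m : Kernel X X) (x y : X) : ℝ :=
  1 - (transportDist (m x) (m y)).toReal / dist x y

/-- The spread `σ(x) = (½ ∬ d(y, z)² dm_x(y) dm_x(z))^{1/2}`. -/
def spread {X : Type*} [MetricSpace X] [MeasurableSpace X] (m : Kernel X X) (x : X) : ℝ≥0∞ :=
  ((∫⁻ y, ∫⁻ z, edist y z ^ 2 ∂(m x) ∂(m x)) / 2) ^ (1 / 2 : ℝ)

/-- `σ_∞ = sup_x ½ diam Supp m_x`. -/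
def spreadInfty {X : Type*} [MetricSpace X] [MeasurableSpace X] (m : Kernel X X) : ℝ≥0∞ :=
  ⨆ x, Metric.ediam (m x).support / 2

/-- The local dimension `n_x = σ(x)² / sup {Var_{m_x} f : f 1-Lipschitz}`. -/
def localDim {X : Type*} [MetricSpace X] [MeasurableSpace X] (m : Kernel X X) (x : X) : ℝ≥0∞ :=
  spread m x ^ 2 / ⨆ (f : X → ℝ) (_ : LipschitzWith 1 f), evariance f (m x)

/-- `κ₋(x, y) = d(x, y)⁻¹ ∫ (d(x, y) - d(a, b))₋ dξ(a, b)` for a coupling `ξ` of `m_x` and `m_y`.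
The negative part of `u` is `max (-u) 0`. -/
def kappaMinus {X : Type*} [MetricSpace X] [MeasurableSpace X] (ξ : Measure (X × X)) (x y : X) :
    ℝ≥0∞ :=
  (∫⁻ p, ENNReal.ofReal (dist p.1 p.2 - dist x y) ∂ξ) / edist x y

/-- The unstability `U = sup_{x ≠ y} κ₋(x, y) / κ(x, y)`, computed with the couplings `ξ x y` of
`m_x` and `m_y` (meaningful when the curvature is positive). -/
def unstability {X : Type*} [MetricSpace X] [MeasurableSpace X] (m : Kernel X X)
    (ξ : X → X → Measure (X × X)) : ℝ≥0∞ :=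
  ⨆ (x : X) (y : X) (_ : x ≠ y), kappaMinus (ξ x y) x y / ENNReal.ofReal (ricciCurv m x y)

/-- The `l`-range gradient
`Df(x) = sup_{y ≠ y'} |f(y) - f(y')| / d(y, y') * exp(-l d(x, y) - l d(x, y'))`. -/
def rangeGrad {X : Type*} [MetricSpace X] (l : ℝ) (f : X → ℝ) (x : X) : ℝ≥0∞ :=
  ⨆ (y : X) (y' : X) (_ : y ≠ y'),
    edist (f y) (f y') / edist y y' * ENNReal.ofReal (Real.exp (-l * dist x y - l * dist x y'))

/-- The entropy `Ent_ν f = ∫ f log f dν - (∫ f dν) log (∫ f dν)` of a positive function `f` with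
respect to a probability measure; it is `∞` if `f` or `f log f` is not integrable. -/
def entropy {X : Type*} [MeasurableSpace X] (ν : Measure X) (f : X → ℝ) : ℝ≥0∞ :=
  open scoped Classical in
  if Integrable f ν ∧ Integrable (fun x => f x * Real.log (f x)) ν then
    ENNReal.ofReal (∫ x, f x * Real.log (f x) ∂ν - (∫ x, f x ∂ν) * Real.log (∫ x, f x ∂ν))
  else ∞

/-- The averaging operator `Mg(x) = ∫ g dm_x` on `[0, ∞]`-valued functions. -/
def averaging {X : Type*} [MeasurableSpace X] (m : Kernel X X) (g : X → ℝ≥0∞) (x : X) : ℝ≥0∞ :=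
  ∫⁻ y, g y ∂(m x)

/-- The weight `V(x) = 2 ∑_{t ≥ 0} (1 - κ/2)^{2t} M^{t+1}(σ² / n)(x)`. -/
def weightV {X : Type*} [MetricSpace X] [MeasurableSpace X] (m : Kernel X X) (κ : ℝ) (x : X) :
    ℝ≥0∞ :=
  2 * ∑' t : ℕ, ENNReal.ofReal ((1 - κ / 2) ^ (2 * t)) *
    (averaging m)^[t + 1] (fun y => spread m y ^ 2 / localDim m y) x

end

set_option linter.unusedSectionVars false

/-! The supremum defining `Df` is awkward to average, so the proof carries pairs `(f, g)`
(`GradBound`): `g` controls the increments of `f` up to a factor `e^{l d}` and itself changes by at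
most `e^{2 l d}`. The range gradient is one such `g` (`gradBound_rangeGrad`). The central fact,
`gradBound_avg`, is that the averaging operator `M` sends `(f, g)` to `(Mf, (1 - κ/2) Mg)`. To see
this, integrate the increment bound over an optimal coupling. The cost `d` appears with a weight
built from `g` and `e^{l d}`, which oscillates on the supports by a factor at most `e^{12 l s}`,
where `s = σ_∞`. The smallness of `l` relative to `U` ensures that this weight spoils at most half
of the curvature (`integral_weight_mul_dist_le`).

Consequently `M^t f` is Lipschitz on the support of `m x` with constant `e^{1/4} (1 - κ/2)^t M^{t+1}
g(x)`, which bounds its local variance (`evariance_le`). For `Φ(u) = u²` and `Φ(u) = u log u`,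
invariance of `ν` splits the global `Φ`-entropy of `f` into the mean local entropy plus the global
entropy of `Mf`. Iterating gives a sum of local entropies (`phiEntropy_le_tsum`). The remainder
vanishes because `ν` has exponential moments (`tendsto_variance`), and `u log u` reduces to the
variance by `Ent ≤ Var / mean`.

Jensen's inequality `(M^{t+1} g)² / M^{t+1} w ≤ M^{t+1}(g² / w)`, with `w = 1` or `w = f`, leaves a
series whose terms are `(1 - κ/2)^{2t} ∫ maxVariance · M^{t+1}(g² / w) dν` up to the factor
`e^{1/2}`. A uniform bound on the local variances, with invariance, gives a geometric series. Under
reversibility, self-adjointness of `M` moves `M^{t+1}` onto the variances and produces `V`. -/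

theorem MeasureTheory.integrable_of_continuous_of_ae_le {Y : Type*} [TopologicalSpace Y]
    [TopologicalSpace.PseudoMetrizableSpace Y] [SecondCountableTopology Y] [MeasurableSpace Y]
    [OpensMeasurableSpace Y] {μ : Measure Y} [IsFiniteMeasure μ] {h : Y → ℝ} (hc : Continuous h)
    (C : ℝ) (hC : ∀ᵐ y ∂μ, |h y| ≤ C) : Integrable h μ :=
  Integrable.of_bound hc.aestronglyMeasurable C hC

/-- The quantitative consequences of positive curvature and of the range condition that the proof
of the functional inequalities uses. -/
structure ContractiveWalk {X : Type*} [MetricSpace X] [MeasurableSpace X] (m : Kernel X X)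
    (ξ : X → X → Measure (X × X)) (κ l s : ℝ) : Prop where
  markov : IsMarkovKernel m
  κ_pos : 0 < κ
  κ_le_one : κ ≤ 1
  l_pos : 0 < l
  s_nonneg : 0 ≤ s
  small : 12 * l * s ≤ 1 / 2
  coupling : ∀ x y, IsCoupling (ξ x y) (m x) (m y)
  dist_le : ∀ x, ∀ z ∈ (m x).support, ∀ w ∈ (m x).support, dist z w ≤ 2 * s
  curv : ∀ x y, x ≠ y → ∫ p, dist p.1 p.2 ∂ξ x y ≤ (1 - κ) * dist x y
  stable : ∀ x y, x ≠ y →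
    (Real.exp (12 * l * s) - 1) * ∫ p, max (dist p.1 p.2 - dist x y) 0 ∂ξ x y ≤
      (1 - Real.exp (12 * l * s) / 2) * (dist x y - ∫ p, dist p.1 p.2 ∂ξ x y)

/-- `g` is a positive upper gradient of `f` at exponential range `l`. -/
structure GradBound {X : Type*} [MetricSpace X] (l : ℝ) (f g : X → ℝ) : Prop where
  nonneg : ∀ z, 0 ≤ g z
  le : ∀ z z', |f z - f z'| ≤ g z * dist z z' * Real.exp (l * dist z z')
  slow : ∀ z z', g z ≤ Real.exp (2 * l * dist z z') * g z'

/-- The average of a real function under one step of the random walk. -/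
noncomputable def avg {X : Type*} [MeasurableSpace X] (m : Kernel X X) (f : X → ℝ) (x : X) : ℝ :=
  ∫ y, f y ∂(m x)

/-! ### Marginals of couplings -/

section Coupling

variable {X : Type*} [MeasurableSpace X] {ζ : Measure (X × X)} {μ μ' : Measure X}

theorem IsCoupling.isProbabilityMeasure [IsProbabilityMeasure μ] (h : IsCoupling ζ μ μ') :
    IsProbabilityMeasure ζ := by
  have h1 := h.1
  constructor
  have : ζ.map Prod.fst Set.univ = 1 := by rw [h1]; exact measure_univ
  rwa [Measure.map_apply measurable_fst MeasurableSet.univ, Set.preimage_univ] at this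

theorem IsCoupling.ae_fst (h : IsCoupling ζ μ μ') {p : X → Prop} (hp : ∀ᵐ x ∂μ, p x) :
    ∀ᵐ q ∂ζ, p q.1 := by
  rw [← h.1] at hp
  exact ae_of_ae_map measurable_fst.aemeasurable hp

theorem IsCoupling.ae_snd (h : IsCoupling ζ μ μ') {p : X → Prop} (hp : ∀ᵐ x ∂μ', p x) :
    ∀ᵐ q ∂ζ, p q.2 := by
  rw [← h.2] at hp
  exact ae_of_ae_map measurable_snd.aemeasurable hp

theorem IsCoupling.integral_fst (h : IsCoupling ζ μ μ') {f : X → ℝ}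
    (hf : AEStronglyMeasurable f μ) : ∫ q, f q.1 ∂ζ = ∫ x, f x ∂μ := by
  obtain ⟨h1, _⟩ := h
  subst h1
  exact (integral_map measurable_fst.aemeasurable hf).symm

theorem IsCoupling.integral_snd (h : IsCoupling ζ μ μ') {f : X → ℝ}
    (hf : AEStronglyMeasurable f μ') : ∫ q, f q.2 ∂ζ = ∫ x, f x ∂μ' := by
  obtain ⟨_, h1⟩ := h
  subst h1
  exact (integral_map measurable_snd.aemeasurable hf).symm

end Coupling

/-! ### Continuity of functions with a gradient bound -/

namespace GradBound

variable {X : Type*} [MetricSpace X] {l : ℝ} {f g : X → ℝ}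

theorem continuous (h : GradBound l f g) : Continuous f := by
  rw [continuous_iff_continuousAt]
  intro z
  have h1 : Filter.Tendsto (fun z' => g z * dist z z' * Real.exp (l * dist z z')) (nhds z)
      (nhds (g z * dist z z * Real.exp (l * dist z z))) := by
    apply Continuous.tendsto; fun_prop
  simp only [dist_self, mul_zero, zero_mul] at h1
  refine tendsto_iff_dist_tendsto_zero.2 (squeeze_zero (fun _ => dist_nonneg) (fun z' => ?_) h1)
  rw [dist_comm, Real.dist_eq]
  exact h.le z z'

theorem continuous_weight (h : GradBound l f g) : Continuous g := by
  rw [continuous_iff_continuousAt]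
  intro z
  have h1 : Filter.Tendsto (fun z' => Real.exp (2 * l * dist z' z) * g z) (nhds z)
      (nhds (Real.exp (2 * l * dist z z) * g z)) := by
    apply Continuous.tendsto; fun_prop
  have h2 : Filter.Tendsto (fun z' => Real.exp (-(2 * l * dist z' z)) * g z) (nhds z)
      (nhds (Real.exp (-(2 * l * dist z z)) * g z)) := by
    apply Continuous.tendsto; fun_prop
  simp only [dist_self, mul_zero, Real.exp_zero, one_mul, neg_zero] at h1 h2
  refine tendsto_of_tendsto_of_tendsto_of_le_of_le h2 h1 (fun z' => ?_) (fun z' => h.slow z' z)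
  have := h.slow z z'
  simp only
  rw [Real.exp_neg, inv_mul_le_iff₀ (Real.exp_pos _), dist_comm]
  exact this

end GradBound

/-! ### Weighted contraction along couplings -/

namespace ContractiveWalk

variable {X : Type*} [MetricSpace X] [SecondCountableTopology X] [MeasurableSpace X] [BorelSpace X]
  {m : Kernel X X} {ξ : X → X → Measure (X × X)} {κ l s : ℝ}

theorem isProbabilityMeasure (H : ContractiveWalk m ξ κ l s) (x y : X) :
    IsProbabilityMeasure (ξ x y) :=
  have := H.markov
  (H.coupling x y).isProbabilityMeasure

theorem ae_mem_support (H : ContractiveWalk m ξ κ l s) (x y : X) :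
    ∀ᵐ p ∂ξ x y, p.1 ∈ (m x).support ∧ p.2 ∈ (m y).support :=
  ((H.coupling x y).ae_fst (Measure.support_mem_ae (μ := m x))).and
    ((H.coupling x y).ae_snd (Measure.support_mem_ae (μ := m y)))

theorem nonempty_support (H : ContractiveWalk m ξ κ l s) (x : X) : (m x).support.Nonempty :=
  have := H.markov
  Measure.nonempty_support (IsProbabilityMeasure.ne_zero (m x))

/-- Each support has diameter at most `2 * s`, and both endpoints move. -/
theorem dist_bound (H : ContractiveWalk m ξ κ l s) {x y p q z w : X} (hp : p ∈ (m x).support)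
    (hz : z ∈ (m x).support) (hq : q ∈ (m y).support) (hw : w ∈ (m y).support) :
    dist z w ≤ dist p q + 4 * s := by
  have h1 := H.dist_le x z hz p hp
  have h2 := H.dist_le y q hq w hw
  have := dist_triangle4 z p q w
  linarith

theorem integrable_dist (H : ContractiveWalk m ξ κ l s) (x y : X) :
    Integrable (fun p : X × X => dist p.1 p.2) (ξ x y) := by
  have := H.isProbabilityMeasure x y
  obtain ⟨p, hp⟩ := H.nonempty_support x
  obtain ⟨q, hq⟩ := H.nonempty_support y
  refine integrable_of_continuous_of_ae_le (by fun_prop) (dist p q + 4 * s) ?_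
  filter_upwards [H.ae_mem_support x y] with w hw
  rw [abs_of_nonneg dist_nonneg]
  exact H.dist_bound hp hw.1 hq hw.2

/-- A weight of small oscillation does not spoil the contraction. -/
theorem integral_weight_mul_dist_le (H : ContractiveWalk m ξ κ l s) {x y : X} (hxy : x ≠ y)
    {A : X × X → ℝ} (hA : Continuous A) (hA0 : ∀ p, 0 ≤ A p)
    (hosc : ∀ z ∈ (m x).support, ∀ w ∈ (m y).support, ∀ z' ∈ (m x).support,
      ∀ w' ∈ (m y).support, A (z, w) ≤ Real.exp (12 * l * s) * A (z', w')) :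
    Integrable A (ξ x y) ∧ Integrable (fun p => A p * dist p.1 p.2) (ξ x y) ∧
    ∫ p, A p * dist p.1 p.2 ∂ξ x y ≤ (1 - κ / 2) * dist x y * ∫ p, A p ∂ξ x y := by
  have := H.isProbabilityMeasure x y
  obtain ⟨p, hp⟩ := H.nonempty_support x
  obtain ⟨q, hq⟩ := H.nonempty_support y
  set S : Set (X × X) := (m x).support ×ˢ (m y).support with hS
  -- By the oscillation hypothesis, `a ≤ A ≤ E * a` on the product of the supports.
  set a : ℝ := sInf (A '' S) with ha
  set E := Real.exp (12 * l * s) with hE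
  have hE1 : 1 ≤ E := Real.one_le_exp (by have := H.l_pos; have := H.s_nonneg; positivity)
  have hbdd : BddBelow (A '' S) := ⟨0, by rintro _ ⟨w, -, rfl⟩; exact hA0 w⟩
  have hne : (A '' S).Nonempty := ⟨A (p, q), _, ⟨hp, hq⟩, rfl⟩
  have ha0 : 0 ≤ a := le_csInf hne (by rintro _ ⟨w, -, rfl⟩; exact hA0 w)
  have hlow : ∀ w ∈ S, a ≤ A w := fun w hw => csInf_le hbdd ⟨w, hw, rfl⟩
  have hup : ∀ w ∈ S, A w ≤ E * a := by
    intro w hw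
    have : A w / E ≤ a := le_csInf hne (by
      rintro _ ⟨w', hw', rfl⟩
      rw [div_le_iff₀ (by positivity), mul_comm]
      exact hosc w.1 hw.1 w.2 hw.2 w'.1 hw'.1 w'.2 hw'.2)
    rwa [div_le_iff₀ (by positivity), mul_comm] at this
  have hae : ∀ᵐ w ∂ξ x y, w ∈ S := H.ae_mem_support x y
  have iA : Integrable A (ξ x y) := by
    refine integrable_of_continuous_of_ae_le hA (E * a) ?_
    filter_upwards [hae] with w hw
    rw [abs_of_nonneg (hA0 w)]
    exact hup w hw
  have iAd : Integrable (fun p : X × X => A p * dist p.1 p.2) (ξ x y) := by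
    refine integrable_of_continuous_of_ae_le (by fun_prop) (E * a * (dist p q + 4 * s)) ?_
    filter_upwards [hae] with w hw
    rw [abs_of_nonneg (mul_nonneg (hA0 w) dist_nonneg)]
    exact mul_le_mul (hup w hw) (H.dist_bound hp hw.1 hq hw.2) dist_nonneg (by positivity)
  refine ⟨iA, iAd, ?_⟩
  have id := H.integrable_dist x y
  have ic : Integrable (fun p : X × X => dist p.1 p.2 - dist x y) (ξ x y) :=
    id.sub (integrable_const _)
  have im : Integrable (fun p : X × X => max (dist p.1 p.2 - dist x y) 0) (ξ x y) := ic.pos_part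
  -- `A` is replaced by its upper bound `E * a` where the distance grows and by its lower bound `a`
  -- where it shrinks.
  have key : ∫ p, (A p * dist p.1 p.2 - dist x y * A p) ∂ξ x y ≤
      ∫ p, ((E * a - a) * max (dist p.1 p.2 - dist x y) 0
        + a * (dist p.1 p.2 - dist x y)) ∂ξ x y := by
    refine integral_mono_ae (iAd.sub (iA.const_mul _))
      ((im.const_mul _).add (ic.const_mul _)) ?_
    filter_upwards [hae] with w hw
    have h1 := hlow w hw
    have h2 := hup w hw
    rcases le_total 0 (dist w.1 w.2 - dist x y) with h | h
    · simp only [max_eq_left h]; nlinarith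
    · simp only [max_eq_right h]; nlinarith
  rw [integral_sub iAd (iA.const_mul _), integral_const_mul,
    integral_add (im.const_mul _) (ic.const_mul _), integral_const_mul, integral_const_mul,
    integral_sub id (integrable_const _)] at key
  simp only [integral_const, probReal_univ, one_smul] at key
  -- With `δ = dist x y - D`, `stable` bounds the right side of `key` by `-(E / 2) * a * δ`. Then `δ
  -- ≥ κ * dist x y` and `∫ A ≤ E * a` give `-(κ / 2) * dist x y * ∫ A`.
  have hst := H.stable x y hxy
  have hcu := H.curv x y hxy
  have hIA : ∫ p, A p ∂ξ x y ≤ E * a := by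
    have : ∫ p, A p ∂ξ x y ≤ ∫ p, E * a ∂ξ x y :=
      integral_mono_ae iA (integrable_const _) (by filter_upwards [hae] with w hw using hup w hw)
    simpa using this
  have hIA0 : 0 ≤ ∫ p, A p ∂ξ x y := integral_nonneg hA0
  set D := ∫ p, dist p.1 p.2 ∂ξ x y
  set P := ∫ p, max (dist p.1 p.2 - dist x y) 0 ∂ξ x y
  set I := ∫ p, A p ∂ξ x y
  have h3 := mul_le_mul_of_nonneg_left hst ha0
  have hκd : κ * dist x y ≤ dist x y - D := by linarith
  have hκd0 : 0 ≤ κ * dist x y := mul_nonneg H.κ_pos.le dist_nonneg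
  have h4 : I * (κ * dist x y) ≤ E * a * (dist x y - D) :=
    mul_le_mul hIA hκd hκd0 (by positivity)
  nlinarith

end ContractiveWalk

/-! ### Gradient contraction and the local Poincaré inequality -/

/-- The largest variance of a `1`-Lipschitz function. -/
noncomputable def maxVariance {X : Type*} [MetricSpace X] [MeasurableSpace X]
    (μ : Measure X) : ℝ≥0∞ := ⨆ (f : X → ℝ) (_ : LipschitzWith 1 f), evariance f μ

theorem evariance_le_of_lipschitzWith {X : Type*} [MetricSpace X] [MeasurableSpace X]
    (μ : Measure X) [IsProbabilityMeasure μ] {F : X → ℝ} {L : ℝ≥0} (hF : LipschitzWith L F) :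
    evariance F μ ≤ ENNReal.ofReal ((L : ℝ) ^ 2) * maxVariance μ := by
  rcases eq_or_ne L 0 with rfl | hL
  · have hconst : ∀ x y, F x = F y := fun x y => by
      have := hF.dist_le_mul x y
      simp only [NNReal.coe_zero, zero_mul] at this
      exact dist_le_zero.1 this
    obtain ⟨o⟩ := nonempty_of_isProbabilityMeasure μ
    have h1 : F = fun _ => F o := funext fun x => hconst x o
    rw [h1]
    simp [evariance]
  · have hL' : (L : ℝ) ≠ 0 := by exact_mod_cast hL
    have h1 : LipschitzWith 1 fun x => (L : ℝ)⁻¹ * F x := by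
      refine LipschitzWith.of_dist_le_mul fun x y => ?_
      have := hF.dist_le_mul x y
      rw [Real.dist_eq, ← mul_sub, abs_mul, abs_inv, NNReal.abs_eq, ← Real.dist_eq,
        inv_mul_le_iff₀ (by positivity)]
      simpa using this
    have h2 : F = fun x => (L : ℝ) * ((L : ℝ)⁻¹ * F x) := by
      funext x; field_simp
    rw [h2, evariance_mul]
    gcongr
    exact le_iSup₂_of_le (fun x => (L : ℝ)⁻¹ * F x) h1 le_rfl

namespace ContractiveWalk

variable {X : Type*} [MetricSpace X] [SecondCountableTopology X] [MeasurableSpace X] [BorelSpace X]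
  {m : Kernel X X} {ξ : X → X → Measure (X × X)} {κ l s : ℝ} {f g : X → ℝ}

theorem weight_le (H : ContractiveWalk m ξ κ l s) (hg : GradBound l f g) {x z w : X}
    (hz : z ∈ (m x).support) (hw : w ∈ (m x).support) :
    g z ≤ Real.exp (2 * l * (2 * s)) * g w := by
  refine (hg.slow z w).trans (mul_le_mul_of_nonneg_right (Real.exp_le_exp.2 ?_) (hg.nonneg w))
  exact mul_le_mul_of_nonneg_left (H.dist_le x z hz w hw) (by have := H.l_pos; positivity)

theorem integrable_of_continuous (H : ContractiveWalk m ξ κ l s) {h : X → ℝ} (hc : Continuous h)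
    (x : X) (C : ℝ) (hC : ∀ z ∈ (m x).support, |h z| ≤ C) : Integrable h (m x) := by
  have := H.markov
  refine integrable_of_continuous_of_ae_le hc C ?_
  filter_upwards [Measure.support_mem_ae (μ := m x)] with z hz using hC z hz

theorem integrable_weight (H : ContractiveWalk m ξ κ l s) (hg : GradBound l f g) (x : X) :
    Integrable g (m x) := by
  obtain ⟨p, hp⟩ := H.nonempty_support x
  refine H.integrable_of_continuous hg.continuous_weight x
    (Real.exp (2 * l * (2 * s)) * g p) fun z hz => ?_
  rw [abs_of_nonneg (hg.nonneg z)]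
  exact H.weight_le hg hz hp

theorem exists_abs_le (H : ContractiveWalk m ξ κ l s) (hg : GradBound l f g) (x : X) :
    ∃ C, ∀ z ∈ (m x).support, |f z| ≤ C := by
  obtain ⟨p, hp⟩ := H.nonempty_support x
  refine ⟨|f p| + g p * (2 * s) * Real.exp (l * (2 * s)), fun z hz => ?_⟩
  have h1 := hg.le p z
  have h2 : g p * dist p z * Real.exp (l * dist p z) ≤ g p * (2 * s) * Real.exp (l * (2 * s)) := by
    have h3 := H.dist_le x p hp z hz
    have h4 := hg.nonneg p
    have h5 := H.l_pos.le
    have h6 := H.s_nonneg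
    gcongr
  have h3 := abs_sub_abs_le_abs_sub (f z) (f p)
  rw [abs_sub_comm] at h3
  linarith

theorem integrable (H : ContractiveWalk m ξ κ l s) (hg : GradBound l f g) (x : X) :
    Integrable f (m x) := by
  obtain ⟨C, hC⟩ := H.exists_abs_le hg x
  exact H.integrable_of_continuous hg.continuous x C hC

/-- Write `A` for the weight and `d₀ = dist x y`. The convexity bound `e^{θ d₀} ≥ e^{θ d} (1 + θ (d₀
- d))` reduces the third claim to `∫ A d ≤ d₀ ∫ A`, which the weighted contraction provides. In
`gradBound_avg`, `θ = l` handles increments and `θ = 2 * l` handles the slow variation of the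
weight. -/
theorem exp_weight_contract (H : ContractiveWalk m ξ κ l s) (hg : GradBound l f g) {x y : X}
    (hxy : x ≠ y) {θ : ℝ} (hθ0 : 0 ≤ θ) (hθ : θ ≤ 2 * l) :
    Integrable (fun p : X × X => Real.exp (θ * dist p.1 p.2) * g p.1) (ξ x y) ∧
    Integrable (fun p : X × X => Real.exp (θ * dist p.1 p.2) * g p.1 * dist p.1 p.2) (ξ x y) ∧
    ∫ p, Real.exp (θ * dist p.1 p.2) * g p.1 ∂ξ x y ≤ Real.exp (θ * dist x y) * avg m g x ∧
    ∫ p, Real.exp (θ * dist p.1 p.2) * g p.1 * dist p.1 p.2 ∂ξ x y ≤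
      Real.exp (θ * dist x y) * ((1 - κ / 2) * dist x y * avg m g x) := by
  have hgc := hg.continuous_weight
  have := H.isProbabilityMeasure x y
  have := H.markov
  obtain ⟨iA, iAd, hle⟩ := H.integral_weight_mul_dist_le hxy
    (A := fun p => Real.exp (θ * dist p.1 p.2) * g p.1) (by fun_prop)
    (fun p => mul_nonneg (Real.exp_pos _).le (hg.nonneg _)) (by
      intro z hz w hw z' hz' w' hw'
      have h1 := H.dist_bound hz' hz hw' hw
      have h2 := H.weight_le hg hz hz'
      -- The exponent 12 is 8 + 4: the distance changes by at most `4 * s` at rate at most `2 * l`,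
      -- and `g` varies at rate `2 * l` over a support of diameter at most `2 * s`.
      calc Real.exp (θ * dist z w) * g z
          ≤ Real.exp (θ * dist z' w' + 2 * l * (4 * s)) *
            (Real.exp (2 * l * (2 * s)) * g z') := by
              refine mul_le_mul (Real.exp_le_exp.2 ?_) h2 (hg.nonneg _) (Real.exp_pos _).le
              have h3 := mul_le_mul_of_nonneg_left h1 hθ0
              have h4 := mul_le_mul_of_nonneg_right hθ (by linarith [H.s_nonneg] : 0 ≤ 4 * s)
              linarith
        _ = Real.exp (12 * l * s) * (Real.exp (θ * dist z' w') * g z') := by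
              have h5 : 12 * l * s + θ * dist z' w' =
                  θ * dist z' w' + 2 * l * (4 * s) + 2 * l * (2 * s) := by ring
              rw [← mul_assoc, ← mul_assoc (Real.exp (12 * l * s)), ← Real.exp_add,
                ← Real.exp_add, h5])
  have ig : Integrable (fun p : X × X => g p.1) (ξ x y) := by
    have h1 := H.integrable_weight hg x
    rw [← (H.coupling x y).1] at h1
    exact h1.comp_measurable measurable_fst
  have hfst : ∫ p : X × X, g p.1 ∂ξ x y = avg m g x :=
    (H.coupling x y).integral_fst hgc.aestronglyMeasurable
  set IA := ∫ p, Real.exp (θ * dist p.1 p.2) * g p.1 ∂ξ x y with hIA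
  have hIA0 : 0 ≤ IA := integral_nonneg fun p => mul_nonneg (Real.exp_pos _).le (hg.nonneg _)
  have hA : IA ≤ Real.exp (θ * dist x y) * avg m g x := by
    have h1 : ∫ p : X × X, (Real.exp (θ * dist p.1 p.2) * g p.1
          - Real.exp (θ * dist x y) * g p.1) ∂ξ x y ≤
        ∫ p : X × X, θ * (Real.exp (θ * dist p.1 p.2) * g p.1 * dist p.1 p.2
          - dist x y * (Real.exp (θ * dist p.1 p.2) * g p.1)) ∂ξ x y := by
      refine integral_mono (iA.sub (ig.const_mul _)) ((iAd.sub (iA.const_mul _)).const_mul _) ?_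
      intro p
      have h2 := Real.add_one_le_exp (θ * dist x y - θ * dist p.1 p.2)
      have h3 : Real.exp (θ * dist x y) = Real.exp (θ * dist p.1 p.2) *
          Real.exp (θ * dist x y - θ * dist p.1 p.2) := by
        rw [← Real.exp_add]; congr 1; ring
      have h4 : 0 ≤ Real.exp (θ * dist p.1 p.2) * g p.1 :=
        mul_nonneg (Real.exp_pos _).le (hg.nonneg _)
      simp only
      rw [h3]
      nlinarith [mul_le_mul_of_nonneg_left h2 h4]
    rw [integral_sub iA (ig.const_mul _), integral_const_mul, integral_const_mul,
      integral_sub iAd (iA.const_mul _), integral_const_mul, hfst, ← hIA] at h1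
    have h2 : 0 ≤ κ / 2 * dist x y * IA :=
      mul_nonneg (mul_nonneg (by linarith [H.κ_pos]) dist_nonneg) hIA0
    have h3 : θ * (∫ p : X × X, Real.exp (θ * dist p.1 p.2) * g p.1 * dist p.1 p.2 ∂ξ x y
        - dist x y * IA) ≤ 0 := mul_nonpos_of_nonneg_of_nonpos hθ0 (by nlinarith)
    linarith
  refine ⟨iA, iAd, hA, hle.trans ?_⟩
  have h5 : 0 ≤ (1 - κ / 2) * dist x y :=
    mul_nonneg (by linarith [H.κ_le_one]) dist_nonneg
  calc _ ≤ (1 - κ / 2) * dist x y * (Real.exp (θ * dist x y) * avg m g x) :=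
        mul_le_mul_of_nonneg_left hA h5
    _ = _ := by ring

/-- One step of the random walk contracts gradients. -/
theorem gradBound_avg (H : ContractiveWalk m ξ κ l s) (hg : GradBound l f g) :
    GradBound l (avg m f) fun x => (1 - κ / 2) * avg m g x := by
  have hr : 0 ≤ 1 - κ / 2 := by linarith [H.κ_le_one]
  have hl := H.l_pos
  have hav : ∀ x, 0 ≤ avg m g x := fun x => integral_nonneg hg.nonneg
  refine ⟨fun z => mul_nonneg hr (hav z), fun z z' => ?_, fun z z' => ?_⟩
  · rcases eq_or_ne z z' with rfl | hzz
    · simp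
    obtain ⟨-, iAd, -, h⟩ := H.exp_weight_contract hg hzz hl.le (by linarith)
    have hf := hg.continuous
    have i1 : Integrable (fun p : X × X => f p.1) (ξ z z') := by
      have h1 := H.integrable hg z
      rw [← (H.coupling z z').1] at h1
      exact h1.comp_measurable measurable_fst
    have i2 : Integrable (fun p : X × X => f p.2) (ξ z z') := by
      have h1 := H.integrable hg z'
      rw [← (H.coupling z z').2] at h1
      exact h1.comp_measurable measurable_snd
    have e1 : avg m f z - avg m f z' = ∫ p : X × X, (f p.1 - f p.2) ∂ξ z z' := by
      rw [integral_sub i1 i2, (H.coupling z z').integral_fst hf.aestronglyMeasurable,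
        (H.coupling z z').integral_snd hf.aestronglyMeasurable]
      rfl
    rw [e1]
    calc |∫ p : X × X, (f p.1 - f p.2) ∂ξ z z'| ≤ ∫ p : X × X, |f p.1 - f p.2| ∂ξ z z' :=
          abs_integral_le_integral_abs
      _ ≤ ∫ p, Real.exp (l * dist p.1 p.2) * g p.1 * dist p.1 p.2 ∂ξ z z' := by
          refine integral_mono (i1.sub i2).abs iAd fun p => ?_
          have := hg.le p.1 p.2
          simp only
          linarith
      _ ≤ _ := h.trans (le_of_eq (by ring))
  · rcases eq_or_ne z z' with rfl | hzz
    · simp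
    -- The coupling runs from `z'` to `z`, so that the weight on the first coordinate averages to
    -- `avg m g z'`.
    obtain ⟨iA, -, h, -⟩ := H.exp_weight_contract hg hzz.symm (θ := 2 * l) (by positivity) le_rfl
    have hgc := hg.continuous_weight
    have i2 : Integrable (fun p : X × X => g p.2) (ξ z' z) := by
      have h1 := H.integrable_weight hg z
      rw [← (H.coupling z' z).2] at h1
      exact h1.comp_measurable measurable_snd
    have e1 : avg m g z = ∫ p : X × X, g p.2 ∂ξ z' z :=
      ((H.coupling z' z).integral_snd hgc.aestronglyMeasurable).symm
    have h2 : avg m g z ≤ Real.exp (2 * l * dist z z') * avg m g z' := by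
      rw [e1, dist_comm z z']
      refine le_trans (integral_mono i2 iA fun p => ?_) h
      have := hg.slow p.2 p.1
      rwa [dist_comm] at this
    calc _ ≤ (1 - κ / 2) * (Real.exp (2 * l * dist z z') * avg m g z') :=
          mul_le_mul_of_nonneg_left h2 hr
      _ = _ := by ring

theorem gradBound_iterate (H : ContractiveWalk m ξ κ l s) (hg : GradBound l f g) (t : ℕ) :
    GradBound l ((avg m)^[t] f) fun x => (1 - κ / 2) ^ t * (avg m)^[t] g x := by
  induction t with
  | zero => simpa using hg
  | succ t ih =>
    have h := H.gradBound_avg ih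
    rw [Function.iterate_succ_apply', Function.iterate_succ_apply']
    convert h using 2 with x
    simp only [avg]
    rw [integral_const_mul]
    ring

/-- The local Poincaré inequality. -/
theorem evariance_le (H : ContractiveWalk m ξ κ l s) (hg : GradBound l f g) (x : X) :
    evariance f (m x) ≤ ENNReal.ofReal (Real.exp (1 / 2) * avg m g x ^ 2) * maxVariance (m x) := by
  have := H.markov
  have hav : 0 ≤ avg m g x := integral_nonneg hg.nonneg
  have hgx : ∀ z ∈ (m x).support, g z ≤ Real.exp (2 * l * (2 * s)) * avg m g x := by
    intro z hz
    have h1 : ∫ _, g z ∂m x ≤ ∫ w, Real.exp (2 * l * (2 * s)) * g w ∂m x := by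
      refine integral_mono_ae (integrable_const _) ((H.integrable_weight hg x).const_mul _) ?_
      filter_upwards [Measure.support_mem_ae (μ := m x)] with w hw using H.weight_le hg hz hw
    rw [integral_const_mul] at h1
    simpa [avg] using h1
  have hL0 : 0 ≤ Real.exp (1 / 4) * avg m g x := by positivity
  -- Comparing `g` with its mean costs `e^{4 l s}` and the range factor costs `e^{2 l s}`; `small`
  -- gives `6 * l * s ≤ 1 / 4`. The Lipschitz bound holds on the support only, hence the extension
  -- `F` below.
  have hlip : LipschitzOnWith (Real.toNNReal (Real.exp (1 / 4) * avg m g x)) f (m x).support := by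
    refine LipschitzOnWith.of_dist_le_mul fun z hz w hw => ?_
    rw [Real.coe_toNNReal _ hL0, Real.dist_eq]
    have hd := H.dist_le x z hz w hw
    have hl := H.l_pos
    have hs := H.s_nonneg
    have hsm := H.small
    calc |f z - f w| ≤ g z * dist z w * Real.exp (l * dist z w) := hg.le z w
      _ ≤ (Real.exp (2 * l * (2 * s)) * avg m g x) * dist z w * Real.exp (l * (2 * s)) := by
          gcongr
          exact hgx z hz
      _ = Real.exp (6 * l * s) * avg m g x * dist z w := by
          have : Real.exp (6 * l * s) = Real.exp (2 * l * (2 * s)) * Real.exp (l * (2 * s)) := by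
            rw [← Real.exp_add]; congr 1; ring
          rw [this]; ring
      _ ≤ Real.exp (1 / 4) * avg m g x * dist z w := by
          gcongr
          linarith
  obtain ⟨F, hF, hFe⟩ := hlip.extend_real
  have hae : f =ᵐ[m x] F := by
    filter_upwards [Measure.support_mem_ae (μ := m x)] with w hw using hFe hw
  rw [evariance_congr hae]
  refine (evariance_le_of_lipschitzWith (m x) hF).trans (le_of_eq ?_)
  rw [Real.coe_toNNReal _ hL0, mul_pow, ← Real.exp_nat_mul]
  norm_num

end ContractiveWalk

/-! ### A countable dense family of Lipschitz functions -/

section LipschitzFamily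

variable {X : Type*} [MetricSpace X]

theorem LipschitzWith.dist_le_dist {φ : X → ℝ} (hφ : LipschitzWith 1 φ) (x y : X) :
    |φ x - φ y| ≤ dist x y := by
  have := hφ.dist_le_mul x y
  simpa [Real.dist_eq] using this

variable [TopologicalSpace.SeparableSpace X] [Nonempty X]

/-- Countably many `1`-Lipschitz functions that are dense for pointwise convergence. -/
noncomputable def lipFamily (S : {S : Finset (ℕ × ℚ) // S.Nonempty}) (y : X) : ℝ :=
  S.1.inf' S.2 fun p => (p.2 : ℝ) + dist (TopologicalSpace.denseSeq X p.1) y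

theorem lipschitzWith_lipFamily (S : {S : Finset (ℕ × ℚ) // S.Nonempty}) :
    LipschitzWith 1 (lipFamily (X := X) S) := by
  refine LipschitzWith.of_le_add fun x y => ?_
  rw [← sub_le_iff_le_add]
  refine Finset.le_inf' _ _ fun p hp => ?_
  rw [sub_le_iff_le_add]
  refine (Finset.inf'_le _ hp).trans ?_
  have := dist_triangle (TopologicalSpace.denseSeq X p.1) y x
  rw [dist_comm y x] at this
  linarith

/-- Take the minimum of cones with apexes at the first `n + 1` dense points and rational heights
slightly above `φ` there. The Lipschitz property keeps it above `φ`, and an apex near `y` makes it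
close to `φ y`. The bound uniform in `n` is for dominated convergence. -/
theorem exists_tendsto_lipFamily {φ : X → ℝ} (hφ : LipschitzWith 1 φ) :
    ∃ (S : ℕ → {S : Finset (ℕ × ℚ) // S.Nonempty}),
      (∀ n y, |lipFamily (S n) y - φ y| ≤ 2 * dist (TopologicalSpace.denseSeq X 0) y + 1) ∧
      ∀ y, Filter.Tendsto (fun n => lipFamily (S n) y) Filter.atTop (nhds (φ y)) := by
  have hq : ∀ n i : ℕ, ∃ q : ℚ, φ (TopologicalSpace.denseSeq X i) < q ∧
      (q : ℝ) < φ (TopologicalSpace.denseSeq X i) + 1 / (n + 1) := fun n i =>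
    exists_rat_btwn (by have : (0 : ℝ) < 1 / (n + 1) := by positivity
                        linarith)
  choose q hq1 hq2 using hq
  let S : ℕ → {S : Finset (ℕ × ℚ) // S.Nonempty} := fun n =>
    ⟨(Finset.range (n + 1)).image fun i => (i, q n i), by simp⟩
  have hlow : ∀ n y, φ y ≤ lipFamily (S n) y := by
    intro n y
    refine Finset.le_inf' _ _ fun p hp => ?_
    obtain ⟨i, -, rfl⟩ := Finset.mem_image.1 hp
    have h1 := (abs_le.1 (hφ.dist_le_dist (TopologicalSpace.denseSeq X i) y)).1
    have h2 := hq1 n i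
    simp only
    linarith
  have hup : ∀ n i y, i ≤ n →
      lipFamily (S n) y ≤ φ y + 2 * dist (TopologicalSpace.denseSeq X i) y + 1 / (n + 1) := by
    intro n i y hi
    have hmem : (i, q n i) ∈ (S n).1 :=
      Finset.mem_image.2 ⟨i, Finset.mem_range.2 (by omega), rfl⟩
    refine (Finset.inf'_le _ hmem).trans ?_
    have h1 := (abs_le.1 (hφ.dist_le_dist (TopologicalSpace.denseSeq X i) y)).2
    have h2 := hq2 n i
    simp only
    linarith
  refine ⟨S, fun n y => ?_, fun y => ?_⟩
  · rw [abs_of_nonneg (sub_nonneg.2 (hlow n y))]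
    have h1 := hup n 0 y (Nat.zero_le n)
    have h2 : (1 : ℝ) / (n + 1) ≤ 1 := by
      rw [div_le_one (by positivity)]; linarith [(Nat.cast_nonneg n : (0 : ℝ) ≤ n)]
    linarith
  · rw [Metric.tendsto_atTop]
    intro ε hε
    obtain ⟨i, hi⟩ := (TopologicalSpace.denseRange_denseSeq X).exists_dist_lt y
      (by positivity : 0 < ε / 4)
    obtain ⟨N, hN⟩ := exists_nat_one_div_lt (by positivity : 0 < ε / 2)
    refine ⟨max i N, fun n hn => ?_⟩
    rw [Real.dist_eq, abs_of_nonneg (sub_nonneg.2 (hlow n y))]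
    have h1 := hup n i y ((le_max_left _ _).trans hn)
    have h2 : (1 : ℝ) / (n + 1) ≤ 1 / (N + 1) := by
      have : (N : ℝ) ≤ n := by exact_mod_cast (le_max_right _ _).trans hn
      gcongr
    rw [dist_comm] at hi
    linarith

end LipschitzFamily

/-! ### Measurability of the maximal variance, and its relation to the local dimension -/

section MaxVariance

variable {X : Type*} [MetricSpace X] [SecondCountableTopology X] [MeasurableSpace X] [BorelSpace X]

theorem LipschitzWith.integrable_of_dist {μ : Measure X} [IsFiniteMeasure μ] {φ : X → ℝ}
    (hφ : LipschitzWith 1 φ) {o : X} (ho : Integrable (fun y => dist o y) μ) :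
    Integrable φ μ := by
  refine ((integrable_const |φ o|).add ho).mono' hφ.continuous.aestronglyMeasurable
    (ae_of_all _ fun y => ?_)
  have h1 := hφ.dist_le_dist y o
  have h2 := abs_sub_abs_le_abs_sub (φ y) (φ o)
  rw [dist_comm] at h1
  simp only [Real.norm_eq_abs, Pi.add_apply]
  linarith

/-- Under pointwise approximation the means converge by domination, and Fatou's lemma bounds the
variance of the limit. A countable supremum makes `maxVariance (m x)` measurable in `x`, which the
reversible case needs. -/
theorem maxVariance_eq_iSup [Nonempty X] (μ : Measure X) [IsProbabilityMeasure μ]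
    (hμ : ∀ o, Integrable (fun y => dist o y) μ) :
    maxVariance μ = ⨆ S, evariance (lipFamily (X := X) S) μ := by
  refine le_antisymm (iSup₂_le fun φ hφ => ?_)
    (iSup_le fun S => le_iSup₂_of_le _ (lipschitzWith_lipFamily S) le_rfl)
  obtain ⟨S, hS, hlim⟩ := exists_tendsto_lipFamily hφ
  have iφ := hφ.integrable_of_dist (hμ (TopologicalSpace.denseSeq X 0))
  have hmean : Filter.Tendsto (fun n => ∫ y, lipFamily (S n) y ∂μ) Filter.atTop
      (nhds (∫ y, φ y ∂μ)) := by
    refine tendsto_integral_of_dominated_convergence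
      (fun y => |φ y| + (2 * dist (TopologicalSpace.denseSeq X 0) y + 1))
      (fun n => (lipschitzWith_lipFamily (S n)).continuous.aestronglyMeasurable)
      (iφ.abs.add (((hμ _).const_mul 2).add (integrable_const 1)))
      (fun n => ae_of_all _ fun y => ?_) (ae_of_all _ hlim)
    have h1 := hS n y
    have h2 := abs_sub_abs_le_abs_sub (lipFamily (S n) y) (φ y)
    rw [Real.norm_eq_abs]
    linarith
  have hpt : ∀ y, Filter.Tendsto
      (fun n => ‖lipFamily (S n) y - ∫ y, lipFamily (S n) y ∂μ‖ₑ ^ 2) Filter.atTop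
      (nhds (‖φ y - ∫ y, φ y ∂μ‖ₑ ^ 2)) := fun y =>
    ((ENNReal.continuous_pow 2).tendsto _).comp
      ((continuous_enorm.tendsto _).comp ((hlim y).sub hmean))
  calc evariance φ μ = ∫⁻ y, Filter.liminf
        (fun n => ‖lipFamily (S n) y - ∫ y, lipFamily (S n) y ∂μ‖ₑ ^ 2) Filter.atTop ∂μ :=
        lintegral_congr fun y => (hpt y).liminf_eq.symm
    _ ≤ Filter.liminf (fun n => evariance (lipFamily (X := X) (S n)) μ) Filter.atTop := by
        refine lintegral_liminf_le fun n => ?_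
        have := (lipschitzWith_lipFamily (X := X) (S n)).continuous.measurable
        fun_prop
    _ ≤ Filter.liminf (fun _ : ℕ => ⨆ S, evariance (lipFamily (X := X) S) μ) Filter.atTop :=
        Filter.liminf_le_liminf (Filter.Eventually.of_forall fun n =>
          le_iSup (fun S => evariance (lipFamily (X := X) S) μ) (S n))
    _ = _ := Filter.liminf_const _

theorem measurable_evariance_kernel (m : Kernel X X) [IsMarkovKernel m] {φ : X → ℝ}
    (hφ : Measurable φ) : Measurable fun x => evariance φ (m x) := by
  have h1 : Measurable fun x => ∫ y, φ y ∂(m x) :=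
    (StronglyMeasurable.integral_kernel hφ.stronglyMeasurable).measurable
  exact Measurable.lintegral_kernel_prod_right' (κ := m)
    (f := fun p : X × X => ‖φ p.2 - ∫ y, φ y ∂(m p.1)‖ₑ ^ 2)
    (((hφ.comp measurable_snd).sub (h1.comp measurable_fst)).enorm.pow_const 2)

namespace ContractiveWalk

variable {m : Kernel X X} {ξ : X → X → Measure (X × X)} {κ l s : ℝ}

theorem integrable_dist_kernel (H : ContractiveWalk m ξ κ l s) (o x : X) :
    Integrable (fun y => dist o y) (m x) := by
  obtain ⟨p, hp⟩ := H.nonempty_support x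
  refine H.integrable_of_continuous (by fun_prop) x (dist o p + 2 * s) fun z hz => ?_
  rw [abs_of_nonneg dist_nonneg]
  linarith [dist_triangle o p z, H.dist_le x p hp z hz]

theorem measurable_maxVariance (H : ContractiveWalk m ξ κ l s) :
    Measurable fun x => maxVariance (m x) := by
  have := H.markov
  rcases isEmpty_or_nonempty X with hX | hX
  · exact measurable_of_empty _
  have : (fun x => maxVariance (m x)) =
      fun x => ⨆ S, evariance (lipFamily (X := X) S) (m x) :=
    funext fun x => maxVariance_eq_iSup (m x) fun o => H.integrable_dist_kernel o x
  rw [this]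
  exact Measurable.iSup fun S =>
    measurable_evariance_kernel m (lipschitzWith_lipFamily S).continuous.measurable

theorem spread_sq (m : Kernel X X) (x : X) :
    spread m x ^ 2 = (∫⁻ y, ∫⁻ z, edist y z ^ 2 ∂(m x) ∂(m x)) / 2 := by
  rw [spread, ← ENNReal.rpow_natCast, ← ENNReal.rpow_mul]
  norm_num

/-- Formally an identity, by definition of `localDim`; only the conventions at `0` and `∞` need
care. Bounded supports make the spread finite, and zero spread forces a point mass. -/
theorem maxVariance_le (H : ContractiveWalk m ξ κ l s) (x : X) :
    maxVariance (m x) ≤ spread m x ^ 2 / localDim m x := by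
  have := H.markov
  have hfin : spread m x ^ 2 ≠ ∞ := by
    rw [spread_sq]
    have h1 : ∫⁻ y, ∫⁻ z, edist y z ^ 2 ∂(m x) ∂(m x) ≤
        ∫⁻ _, ∫⁻ _, ENNReal.ofReal (2 * s) ^ 2 ∂(m x) ∂(m x) := by
      refine lintegral_mono_ae ?_
      filter_upwards [Measure.support_mem_ae (μ := m x)] with y hy
      refine lintegral_mono_ae ?_
      filter_upwards [Measure.support_mem_ae (μ := m x)] with z hz
      gcongr
      rw [edist_dist]
      exact ENNReal.ofReal_le_ofReal (H.dist_le x y hy z hz)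
    refine (ENNReal.div_lt_top (ne_top_of_le_ne_top ?_ h1) (by simp)).ne
    simp [ENNReal.mul_eq_top]
  change maxVariance (m x) ≤ spread m x ^ 2 / (spread m x ^ 2 / maxVariance (m x))
  by_cases h0 : spread m x ^ 2 = 0
  · have hz : maxVariance (m x) = 0 := by
      rw [spread_sq, ENNReal.div_eq_zero_iff] at h0
      have h1 := h0.resolve_right (by simp)
      rw [lintegral_eq_zero_iff (Measurable.lintegral_prod_right' (by fun_prop :
        Measurable fun p : X × X => edist p.1 p.2 ^ 2))] at h1
      obtain ⟨y, hy⟩ := h1.exists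
      simp only [Pi.zero_apply] at hy
      rw [lintegral_eq_zero_iff (by fun_prop)] at hy
      refine le_antisymm (iSup₂_le fun φ _ => ?_) (zero_le)
      have h2 : φ =ᵐ[m x] fun _ => φ y := by
        filter_upwards [hy] with z hz
        have : y = z := by simpa using hz
        rw [this]
      rw [evariance_congr h2]
      simp [evariance]
    rw [hz]; exact zero_le
  · rw [ENNReal.le_div_iff_mul_le (Or.inr h0) (Or.inr hfin)]
    exact ENNReal.mul_div_le

end ContractiveWalk

end MaxVariance

/-! ### The averaging operator, invariance and drift -/

section Averaging

variable {X : Type*} [MeasurableSpace X] {m : Kernel X X} {ν : Measure X}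

theorem averaging_mono {u v : X → ℝ≥0∞} (h : ∀ x, u x ≤ v x) (x : X) :
    averaging m u x ≤ averaging m v x :=
  lintegral_mono h

theorem averaging_iterate_mono {u v : X → ℝ≥0∞} (h : ∀ x, u x ≤ v x) (t : ℕ) (x : X) :
    (averaging m)^[t] u x ≤ (averaging m)^[t] v x := by
  induction t generalizing x with
  | zero => exact h x
  | succ t ih =>
    rw [Function.iterate_succ_apply', Function.iterate_succ_apply']
    exact averaging_mono ih x

theorem averaging_affine [IsMarkovKernel m] (u : X → ℝ≥0∞) {c : ℝ≥0∞} (hc : c ≠ ∞) (K : ℝ≥0∞) :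
    averaging m (fun x => c * u x + K) = fun x => c * averaging m u x + K := by
  funext x
  simp only [averaging]
  rw [lintegral_add_right _ measurable_const, lintegral_const_mul' _ _ hc]
  simp

theorem averaging_iterate_affine [IsMarkovKernel m] (u : X → ℝ≥0∞) {c : ℝ≥0∞} (hc : c ≠ ∞)
    (K : ℝ≥0∞) (t : ℕ) :
    (averaging m)^[t] (fun x => c * u x + K) = fun x => c * (averaging m)^[t] u x + K := by
  induction t generalizing u with
  | zero => rfl
  | succ t ih =>
    rw [Function.iterate_succ_apply, averaging_affine u hc, ih, Function.iterate_succ_apply]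

theorem averaging_iterate_le_const [IsMarkovKernel m] {u : X → ℝ≥0∞} {K : ℝ≥0∞}
    (h : ∀ x, u x ≤ K) (t : ℕ) (x : X) : (averaging m)^[t] u x ≤ K := by
  induction t generalizing x with
  | zero => exact h x
  | succ t ih =>
    rw [Function.iterate_succ_apply']
    refine (averaging_mono ih x).trans (le_of_eq ?_)
    simp [averaging]

theorem measurable_averaging_iterate {u : X → ℝ≥0∞} (hu : Measurable u) (t : ℕ) :
    Measurable ((averaging m)^[t] u) := by
  induction t with
  | zero => exact hu
  | succ t ih =>
    rw [Function.iterate_succ_apply']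
    exact Measurable.lintegral_kernel ih

theorem ProbabilityTheory.Kernel.Invariant.lintegral_averaging (hν : Kernel.Invariant m ν)
    {u : X → ℝ≥0∞} (hu : Measurable u) : ∫⁻ x, averaging m u x ∂ν = ∫⁻ x, u x ∂ν := by
  conv_rhs => rw [← hν.def]
  exact (Measure.lintegral_bind m.aemeasurable hu.aemeasurable).symm

theorem ProbabilityTheory.Kernel.Invariant.lintegral_averaging_iterate
    (hν : Kernel.Invariant m ν) {u : X → ℝ≥0∞} (hu : Measurable u) (t : ℕ) :
    ∫⁻ x, (averaging m)^[t] u x ∂ν = ∫⁻ x, u x ∂ν := by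
  induction t with
  | zero => rfl
  | succ t ih =>
    rw [Function.iterate_succ_apply', hν.lintegral_averaging (measurable_averaging_iterate hu t), ih]

theorem ProbabilityTheory.Kernel.Invariant.integrable_avg (hν : Kernel.Invariant m ν)
    {f : X → ℝ} (hf : Integrable f ν) : Integrable (avg m f) ν := by
  have h : Integrable f (ν.bind m) := by rwa [hν.def]
  rw [Measure.comp_eq_comp_const_apply] at h
  change Integrable (fun x => ∫ y, f y ∂m x) ν
  simpa using h.integral_comp

theorem ProbabilityTheory.Kernel.Invariant.integral_avg (hν : Kernel.Invariant m ν)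
    {f : X → ℝ} (hf : Integrable f ν) : ∫ x, avg m f x ∂ν = ∫ x, f x ∂ν := by
  have h : Integrable f (ν.bind m) := by rwa [hν.def]
  conv_rhs => rw [← hν.def]
  rw [Measure.comp_eq_comp_const_apply] at h ⊢
  rw [Kernel.integral_comp h]
  simp [avg]

/-- A drift condition controls the integral of a Lyapunov function. -/
theorem lintegral_le_of_drift [IsMarkovKernel m] [IsProbabilityMeasure ν]
    (hν : Kernel.Invariant m ν) {W : X → ℝ≥0∞} (hW : Measurable W) (hWfin : ∀ x, W x ≠ ∞)
    {K : ℝ≥0∞} (hdrift : ∀ x, averaging m W x ≤ 2⁻¹ * W x + K) :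
    ∫⁻ x, W x ∂ν ≤ 2 * K := by
  -- The constant `2 * K` bounds the sum `K (1 + 1/2 + 1/4 + ⋯)`.
  have hit : ∀ t x, (averaging m)^[t] W x ≤ 2⁻¹ ^ t * W x + 2 * K := by
    intro t
    induction t with
    | zero => intro x; simp
    | succ t ih =>
      intro x
      rw [Function.iterate_succ_apply]
      refine (averaging_iterate_mono hdrift t x).trans ?_
      rw [averaging_iterate_affine W (by simp) K t]
      calc 2⁻¹ * (averaging m)^[t] W x + K ≤ 2⁻¹ * (2⁻¹ ^ t * W x + 2 * K) + K := by
            gcongr; exact ih x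
        _ = 2⁻¹ ^ (t + 1) * W x + 2 * K := by
            rw [mul_add, ← mul_assoc 2⁻¹ 2 K, ENNReal.inv_mul_cancel (by simp) (by simp), one_mul,
              ← mul_assoc, add_assoc, pow_succ', two_mul]
  -- `W` is not known to be integrable, so it is truncated at `n`. Invariance inserts `M^t` for
  -- free, and `t → ∞` is taken under the domination by `n`.
  have htr : ∀ n : ℕ, ∫⁻ x, min (W x) n ∂ν ≤ 2 * K := by
    intro n
    have hm : Measurable fun x => min (W x) (n : ℝ≥0∞) := hW.min measurable_const
    have hb : ∀ t : ℕ, ∫⁻ x, min (W x) n ∂ν ≤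
        ∫⁻ x, min (2⁻¹ ^ t * W x + 2 * K) n ∂ν := by
      intro t
      rw [← hν.lintegral_averaging_iterate hm t]
      refine lintegral_mono fun x => le_min ?_ ?_
      · exact (averaging_iterate_mono (fun x => min_le_left _ _) t x).trans (hit t x)
      · exact averaging_iterate_le_const (fun x => min_le_right _ _) t x
    have hlim : Filter.Tendsto (fun t : ℕ => ∫⁻ x, min (2⁻¹ ^ t * W x + 2 * K) n ∂ν)
        Filter.atTop (nhds (∫⁻ _, min (0 + 2 * K) n ∂ν)) := by
      refine tendsto_lintegral_of_dominated_convergence (fun _ => (n : ℝ≥0∞))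
        (fun t => ((hW.const_mul _).add_const _).min measurable_const)
        (fun t => ae_of_all _ fun x => min_le_right _ _) (by simp) (ae_of_all _ fun x => ?_)
      have h1 : Filter.Tendsto (fun t : ℕ => (2⁻¹ : ℝ≥0∞) ^ t * W x) Filter.atTop (nhds 0) := by
        have h2 := ENNReal.Tendsto.mul_const (b := W x)
          (ENNReal.tendsto_pow_atTop_nhds_zero_of_lt_one (r := 2⁻¹) (by simp))
          (Or.inr (hWfin x))
        rwa [zero_mul] at h2
      exact (h1.add tendsto_const_nhds).min tendsto_const_nhds
    refine (ge_of_tendsto' hlim hb).trans ?_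
    simp
  have hsup : ∀ x, W x = ⨆ n : ℕ, min (W x) n := by
    intro x
    refine le_antisymm ?_ (iSup_le fun n => min_le_left _ _)
    obtain ⟨n, hn⟩ := ENNReal.exists_nat_gt (hWfin x)
    exact le_iSup_of_le n (le_min le_rfl hn.le)
  calc ∫⁻ x, W x ∂ν = ∫⁻ x, ⨆ n : ℕ, min (W x) n ∂ν := lintegral_congr hsup
    _ = ⨆ n : ℕ, ∫⁻ x, min (W x) n ∂ν := lintegral_iSup
        (fun n => hW.min measurable_const)
        (fun i j hij x => min_le_min le_rfl (by exact_mod_cast hij))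
    _ ≤ 2 * K := iSup_le htr

end Averaging

/-! ### Exponential moments of the invariant distribution and decay of variance -/

namespace ContractiveWalk

variable {X : Type*} [MetricSpace X] [SecondCountableTopology X] [MeasurableSpace X] [BorelSpace X]
  {m : Kernel X X} {ξ : X → X → Measure (X × X)} {κ l s : ℝ} {f g : X → ℝ}
  {ν : Measure X} [IsProbabilityMeasure ν]

/-- Average over the coupling `ξ o x` the length of the path from `o` through `p`, `q.1`, `q.2` to
`z`. Curvature contracts the middle leg, and bounded supports make the estimate hold for every `z`,
not just on average. -/
theorem exists_dist_support_le (H : ContractiveWalk m ξ κ l s) (o : X) :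
    ∃ B, ∀ x, ∀ z ∈ (m x).support, dist o z ≤ B + (1 - κ) * dist o x := by
  obtain ⟨p, hp⟩ := H.nonempty_support o
  have hs := H.s_nonneg
  refine ⟨dist o p + 4 * s, fun x z hz => ?_⟩
  rcases eq_or_ne o x with rfl | hox
  · have h1 := H.dist_le o p hp z hz
    have h2 := dist_triangle o p z
    rw [dist_self, mul_zero]
    linarith
  have := H.isProbabilityMeasure o x
  have h1 : ∫ _, dist o z ∂ξ o x ≤ ∫ q, (dist o p + 4 * s + dist q.1 q.2) ∂ξ o x := by
    refine integral_mono_ae (integrable_const _)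
      ((integrable_const _).add (H.integrable_dist o x)) ?_
    filter_upwards [H.ae_mem_support o x] with q hq
    have h2 := H.dist_le o p hp q.1 hq.1
    have h3 := H.dist_le x q.2 hq.2 z hz
    have h4 := dist_triangle4 o p q.1 q.2
    have h5 := dist_triangle o q.2 z
    linarith
  rw [integral_add (integrable_const _) (H.integrable_dist o x)] at h1
  simp only [integral_const, probReal_univ, one_smul] at h1
  linarith [H.curv o x hox]

/-- The invariant distribution has exponential moments of all orders. -/
theorem integrable_exp_dist (H : ContractiveWalk m ξ κ l s) (hν : Kernel.Invariant m ν) (o : X)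
    {a : ℝ} (ha : 0 ≤ a) : Integrable (fun x => Real.exp (a * dist o x)) ν := by
  have := H.markov
  obtain ⟨B, hB⟩ := H.exists_dist_support_le o
  have hκ := H.κ_pos
  -- `K` covers the points where the contraction does not yet yield a factor `1 / 2`; there `a *
  -- dist o x ≤ (a * B + log 2) / κ`.
  set K : ℝ := Real.exp (a * B + (a * B + Real.log 2) / κ) with hK
  have hreal : ∀ x, ∀ z ∈ (m x).support,
      Real.exp (a * dist o z) ≤ 2⁻¹ * Real.exp (a * dist o x) + K := by
    intro x z hz
    have h1 := mul_le_mul_of_nonneg_left (hB x z hz) ha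
    have hd : 0 ≤ a * dist o x := mul_nonneg ha dist_nonneg
    rcases le_total (a * (B - κ * dist o x)) (-Real.log 2) with h | h
    · have h2 : Real.exp (a * dist o z) ≤ Real.exp (-Real.log 2 + a * dist o x) :=
        Real.exp_le_exp.2 (by linarith)
      rw [Real.exp_add, Real.exp_neg, Real.exp_log (by norm_num)] at h2
      have := Real.exp_pos (a * B + (a * B + Real.log 2) / κ)
      linarith
    · have h3 : a * dist o x ≤ (a * B + Real.log 2) / κ := by
        rw [le_div_iff₀ hκ]; linarith
      have h2 : Real.exp (a * dist o z) ≤ K := Real.exp_le_exp.2 (by nlinarith)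
      have := Real.exp_pos (a * dist o x)
      linarith
  have hmeas : Measurable fun x => ENNReal.ofReal (Real.exp (a * dist o x)) := by fun_prop
  have hdr : ∀ x, averaging m (fun x => ENNReal.ofReal (Real.exp (a * dist o x))) x ≤
      2⁻¹ * ENNReal.ofReal (Real.exp (a * dist o x)) + ENNReal.ofReal K := by
    intro x
    have h2 : (2⁻¹ : ℝ≥0∞) = ENNReal.ofReal 2⁻¹ := by
      rw [ENNReal.ofReal_inv_of_pos (by norm_num)]; simp
    have h1 : averaging m (fun x => ENNReal.ofReal (Real.exp (a * dist o x))) x ≤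
        ∫⁻ _, ENNReal.ofReal (2⁻¹ * Real.exp (a * dist o x) + K) ∂m x := by
      refine lintegral_mono_ae ?_
      filter_upwards [Measure.support_mem_ae (μ := m x)] with z hz
      exact ENNReal.ofReal_le_ofReal (hreal x z hz)
    refine h1.trans (le_of_eq ?_)
    rw [h2, ← ENNReal.ofReal_mul (by norm_num), ← ENNReal.ofReal_add (by positivity) (by positivity)]
    simp
  have hfin := lintegral_le_of_drift hν hmeas (by simp) hdr
  refine ⟨by fun_prop, ?_⟩
  rw [hasFiniteIntegral_iff_ofReal (ae_of_all _ fun _ => (Real.exp_pos _).le)]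
  exact hfin.trans_lt (ENNReal.mul_lt_top (by simp) (by simp))

theorem integrable_of_exp_bound (H : ContractiveWalk m ξ κ l s) (hν : Kernel.Invariant m ν) (o : X)
    {h : X → ℝ} (hm : AEStronglyMeasurable h ν) {a C : ℝ} (ha : 0 ≤ a)
    (hC : ∀ x, |h x| ≤ C * Real.exp (a * dist o x)) : Integrable h ν :=
  ((H.integrable_exp_dist hν o ha).const_mul C).mono' hm (ae_of_all _ hC)

theorem _root_.GradBound.abs_le (hl : 0 < l) (hg : GradBound l f g) (o x : X) :
    |f x| ≤ (|f o| + g o / l) * Real.exp (2 * l * dist o x) := by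
  have h1 := hg.le o x
  have h2 := abs_sub_abs_le_abs_sub (f x) (f o)
  rw [abs_sub_comm] at h2
  have h3 : dist o x ≤ Real.exp (l * dist o x) / l := by
    rw [le_div_iff₀ hl, mul_comm]
    linarith [Real.add_one_le_exp (l * dist o x)]
  have h4 : Real.exp (2 * l * dist o x) = Real.exp (l * dist o x) * Real.exp (l * dist o x) := by
    rw [← Real.exp_add]; congr 1; ring
  have h5 : 1 ≤ Real.exp (2 * l * dist o x) := Real.one_le_exp (by positivity)
  have h6 : g o * dist o x * Real.exp (l * dist o x) ≤
      g o * (Real.exp (l * dist o x) / l) * Real.exp (l * dist o x) := by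
    have := hg.nonneg o
    gcongr
  have h7 : g o * (Real.exp (l * dist o x) / l) * Real.exp (l * dist o x) =
      g o / l * Real.exp (2 * l * dist o x) := by rw [h4]; ring
  nlinarith [abs_nonneg (f o)]

theorem memLp_two (H : ContractiveWalk m ξ κ l s) (hν : Kernel.Invariant m ν)
    (hg : GradBound l f g) : MemLp f 2 ν := by
  obtain ⟨o⟩ := nonempty_of_isProbabilityMeasure ν
  have hf := hg.continuous
  have hl := H.l_pos
  rw [memLp_two_iff_integrable_sq hf.aestronglyMeasurable]
  refine H.integrable_of_exp_bound hν o (hf.pow 2).aestronglyMeasurable (a := 4 * l)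
    (C := (|f o| + g o / l) ^ 2) (by positivity) fun x => ?_
  have h1 := hg.abs_le hl o x
  have h2 : Real.exp (4 * l * dist o x) = Real.exp (2 * l * dist o x) ^ 2 := by
    rw [← Real.exp_nat_mul]; congr 1; push_cast; ring
  rw [abs_pow, h2, ← mul_pow]
  gcongr

theorem integrable_weight_invariant (H : ContractiveWalk m ξ κ l s) (hν : Kernel.Invariant m ν)
    (hg : GradBound l f g) : Integrable g ν := by
  obtain ⟨o⟩ := nonempty_of_isProbabilityMeasure ν
  refine H.integrable_of_exp_bound hν o hg.continuous_weight.aestronglyMeasurable (a := 2 * l)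
    (C := g o) (by linarith [H.l_pos]) fun x => ?_
  rw [abs_of_nonneg (hg.nonneg x), mul_comm, dist_comm]
  exact hg.slow x o

theorem integral_avg_iterate (hν : Kernel.Invariant m ν) {h : X → ℝ} (hh : Integrable h ν)
    (t : ℕ) : Integrable ((avg m)^[t] h) ν ∧ ∫ x, (avg m)^[t] h x ∂ν = ∫ x, h x ∂ν := by
  induction t with
  | zero => exact ⟨hh, rfl⟩
  | succ t ih =>
    rw [Function.iterate_succ_apply']
    exact ⟨hν.integrable_avg ih.1, (hν.integral_avg ih.1).trans ih.2⟩

/-- The variance is at most the second moment about `f o`, which the increment bound from `o`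
controls. `C` depends on `o` but not on the pair, so it serves all iterates at once. -/
theorem variance_le_weight_sq (H : ContractiveWalk m ξ κ l s) (hν : Kernel.Invariant m ν) (o : X) :
    ∃ C, 0 ≤ C ∧ ∀ f g : X → ℝ, GradBound l f g → variance f ν ≤ g o ^ 2 * C := by
  have hl := H.l_pos
  refine ⟨∫ x, (dist o x * Real.exp (l * dist o x)) ^ 2 ∂ν,
    integral_nonneg fun x => by positivity, fun f g hg => ?_⟩
  have hf := hg.continuous
  have hi : Integrable (fun x => (dist o x * Real.exp (l * dist o x)) ^ 2) ν := by
    refine H.integrable_of_exp_bound hν o (by fun_prop) (a := 4 * l)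
      (C := (l ^ 2)⁻¹) (by positivity) fun x => ?_
    rw [abs_of_nonneg (by positivity), ← div_eq_inv_mul, le_div_iff₀ (by positivity)]
    have h3 : l * dist o x ≤ Real.exp (l * dist o x) := by
      linarith [Real.add_one_le_exp (l * dist o x)]
    have h4 : Real.exp (4 * l * dist o x) = (Real.exp (l * dist o x) *
        Real.exp (l * dist o x)) ^ 2 := by
      rw [← Real.exp_add, ← Real.exp_nat_mul]; congr 1; push_cast; ring
    rw [h4, ← mul_pow]
    refine pow_le_pow_left₀ (by positivity) ?_ 2
    nlinarith [Real.exp_pos (l * dist o x)]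
  rw [← variance_sub_const hf.aestronglyMeasurable (f o)]
  refine (variance_le_expectation_sq (by fun_prop)).trans ?_
  rw [← integral_const_mul]
  refine integral_mono_of_nonneg (ae_of_all _ fun x => ?_) (hi.const_mul _) (ae_of_all _ fun x => ?_)
  · simp only [Pi.zero_apply, Pi.pow_apply]; positivity
  · have h1 := hg.le o x
    simp only [Pi.pow_apply]
    rw [← mul_pow, ← sq_abs (f x - f o), abs_sub_comm, ← mul_assoc]
    gcongr

/-- The variance of the iterated averages tends to zero. -/
theorem tendsto_variance (H : ContractiveWalk m ξ κ l s) (hν : Kernel.Invariant m ν)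
    (hg : GradBound l f g) :
    Filter.Tendsto (fun t : ℕ => variance ((avg m)^[t] f) ν) Filter.atTop (nhds 0) := by
  obtain ⟨o⟩ := nonempty_of_isProbabilityMeasure ν
  obtain ⟨C, hC0, hC⟩ := H.variance_le_weight_sq hν o
  have hl := H.l_pos
  have hgi := H.integrable_weight_invariant hν hg
  have hei : Integrable (fun x => Real.exp (-(2 * l * dist o x))) ν := by
    refine integrable_of_continuous_of_ae_le (by fun_prop) 1 (ae_of_all _ fun x => ?_)
    rw [abs_of_pos (Real.exp_pos _)]
    exact Real.exp_le_one_iff.2 (by simp; positivity)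
  set c := ∫ x, Real.exp (-(2 * l * dist o x)) ∂ν with hc
  have hcpos : 0 < c := integral_exp_pos hei
  have hr0 : 0 ≤ 1 - κ / 2 := by linarith [H.κ_le_one]
  have hr1 : 1 - κ / 2 < 1 := by linarith [H.κ_pos]
  -- The values of `M^t g` at the fixed point `o` stay bounded: slow variation compares them with
  -- the `ν`-mean of `M^t g`, which does not depend on `t`.
  have hbound : ∀ t : ℕ, (1 - κ / 2) ^ t * (avg m)^[t] g o ≤
      (1 - κ / 2) ^ t * ((∫ x, g x ∂ν) / c) := by
    intro t
    have ht := H.gradBound_iterate hg t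
    obtain ⟨hti, hte⟩ := integral_avg_iterate hν hgi t
    have h1 : ∫ x, ((1 - κ / 2) ^ t * (avg m)^[t] g o) * Real.exp (-(2 * l * dist o x)) ∂ν ≤
        ∫ x, (1 - κ / 2) ^ t * (avg m)^[t] g x ∂ν := by
      refine integral_mono (hei.const_mul _) (hti.const_mul _) fun x => ?_
      have h2 := ht.slow o x
      simp only
      rw [Real.exp_neg, ← div_eq_mul_inv, div_le_iff₀ (Real.exp_pos _)]
      linarith
    rw [integral_const_mul, integral_const_mul, hte, ← le_div_iff₀ hcpos] at h1
    exact h1.trans (le_of_eq (by ring))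
  have hlim : Filter.Tendsto (fun t : ℕ => ((1 - κ / 2) ^ t * ((∫ x, g x ∂ν) / c)) ^ 2 * C)
      Filter.atTop (nhds 0) := by
    have h1 := (((tendsto_pow_atTop_nhds_zero_of_lt_one hr0 hr1).mul_const
      ((∫ x, g x ∂ν) / c)).pow 2).mul_const C
    simpa using h1
  refine squeeze_zero (fun t => variance_nonneg _ _) (fun t => ?_) hlim
  have ht := H.gradBound_iterate hg t
  exact (hC _ _ ht).trans
    (mul_le_mul_of_nonneg_right (pow_le_pow_left₀ (ht.nonneg o) (hbound t) 2) hC0)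

end ContractiveWalk

/-! ### Decomposition of entropy along the walk -/

theorem ENNReal.ofReal_integral_le_lintegral_ofReal {Y : Type*} [MeasurableSpace Y] (μ : Measure Y)
    (f : Y → ℝ) : ENNReal.ofReal (∫ y, f y ∂μ) ≤ ∫⁻ y, ENNReal.ofReal (f y) ∂μ := by
  by_cases hf : Integrable f μ
  · rw [integral_eq_lintegral_pos_part_sub_lintegral_neg_part hf]
    refine (ENNReal.ofReal_le_ofReal (sub_le_self _ ENNReal.toReal_nonneg)).trans ?_
    exact ENNReal.ofReal_toReal_le
  · simp [integral_undef hf]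

/-- The `Φ`-entropy of `f`. -/
noncomputable def phiEntropy {Y : Type*} [MeasurableSpace Y] (Φ : ℝ → ℝ) (μ : Measure Y)
    (f : Y → ℝ) : ℝ := ∫ y, Φ (f y) ∂μ - Φ (∫ y, f y ∂μ)

section PhiEntropy

variable {X : Type*} [MeasurableSpace X] {m : Kernel X X} {ν : Measure X}

/-- The two occurrences of `∫ Φ(Mf) dν` cancel, and invariance identifies the remaining integrals.
-/
theorem phiEntropy_eq (hν : Kernel.Invariant m ν) {Φ : ℝ → ℝ} {f : X → ℝ} (hf : Integrable f ν)
    (hΦ : Integrable (fun x => Φ (f x)) ν) (hΦ' : Integrable (fun x => Φ (avg m f x)) ν) :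
    phiEntropy Φ ν f = ∫ x, phiEntropy Φ (m x) f ∂ν + phiEntropy Φ ν (avg m f) := by
  have h1 : ∫ x, phiEntropy Φ (m x) f ∂ν =
      ∫ x, avg m (fun y => Φ (f y)) x ∂ν - ∫ x, Φ (avg m f x) ∂ν :=
    integral_sub (hν.integrable_avg hΦ) hΦ'
  rw [h1, hν.integral_avg hΦ, phiEntropy, phiEntropy, hν.integral_avg hf]
  ring

/-- Summing local entropies along the random walk bounds the global entropy. -/
theorem phiEntropy_le_tsum (hν : Kernel.Invariant m ν) {Φ : ℝ → ℝ} {f : X → ℝ}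
    (hf : ∀ t : ℕ, Integrable ((avg m)^[t] f) ν)
    (hΦ : ∀ t : ℕ, Integrable (fun x => Φ ((avg m)^[t] f x)) ν) {B : ℕ → X → ℝ≥0∞}
    (hB : ∀ t x, ENNReal.ofReal (phiEntropy Φ (m x) ((avg m)^[t] f)) ≤ B t x)
    (hlim : Filter.Tendsto (fun t : ℕ => ENNReal.ofReal (phiEntropy Φ ν ((avg m)^[t] f)))
      Filter.atTop (nhds 0)) :
    ENNReal.ofReal (phiEntropy Φ ν f) ≤ ∑' t, ∫⁻ x, B t x ∂ν := by
  have hfin : ∀ T : ℕ, ENNReal.ofReal (phiEntropy Φ ν f) ≤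
      ∑ t ∈ Finset.range T, ∫⁻ x, B t x ∂ν +
        ENNReal.ofReal (phiEntropy Φ ν ((avg m)^[T] f)) := by
    intro T
    induction T with
    | zero => simp
    | succ T ih =>
      refine ih.trans ?_
      rw [Finset.sum_range_succ, add_assoc]
      gcongr
      have h1 := phiEntropy_eq hν (hf T) (hΦ T) (by
        simpa only [Function.iterate_succ_apply'] using hΦ (T + 1))
      rw [Function.iterate_succ_apply', h1]
      refine ENNReal.ofReal_add_le.trans ?_
      gcongr
      exact (ENNReal.ofReal_integral_le_lintegral_ofReal ν _).trans (lintegral_mono (hB T))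
  have hlim' : Filter.Tendsto (fun T : ℕ => ∑' t, ∫⁻ x, B t x ∂ν +
      ENNReal.ofReal (phiEntropy Φ ν ((avg m)^[T] f))) Filter.atTop
      (nhds (∑' t, ∫⁻ x, B t x ∂ν + 0)) := tendsto_const_nhds.add hlim
  rw [add_zero] at hlim'
  refine ge_of_tendsto' hlim' fun T => (hfin T).trans ?_
  gcongr
  exact ENNReal.sum_le_tsum _

theorem phiEntropy_sq {Y : Type*} [MeasurableSpace Y] {μ : Measure Y} [IsProbabilityMeasure μ]
    {f : Y → ℝ} (hf : MemLp f 2 μ) : phiEntropy (fun u => u ^ 2) μ f = variance f μ := by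
  rw [variance_eq_sub hf]
  rfl

theorem abs_mul_log_le {u : ℝ} (hu : 0 < u) : |u * Real.log u| ≤ 1 + u ^ 2 := by
  have h1 := Real.log_le_sub_one_of_pos hu
  have h2 := Real.one_sub_inv_le_log_of_pos hu
  have h3 : u * u⁻¹ = 1 := mul_inv_cancel₀ hu.ne'
  rw [abs_le]
  constructor <;> nlinarith

theorem integrable_mul_log {Y : Type*} [MeasurableSpace Y] {μ : Measure Y} [IsFiniteMeasure μ]
    {f : Y → ℝ} (hf : MemLp f 2 μ) (hpos : ∀ y, 0 < f y) :
    Integrable (fun y => f y * Real.log (f y)) μ := by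
  have h1 : AEStronglyMeasurable (fun y => f y * Real.log (f y)) μ :=
    (hf.1.aemeasurable.mul
      (Real.measurable_log.comp_aemeasurable hf.1.aemeasurable)).aestronglyMeasurable
  exact ((integrable_const 1).add hf.integrable_sq).mono' h1
    (ae_of_all _ fun y => abs_mul_log_le (hpos y))

theorem integral_pos_of_pos {Y : Type*} [MeasurableSpace Y] {μ : Measure Y}
    [IsProbabilityMeasure μ] {f : Y → ℝ} (hf : Integrable f μ) (hpos : ∀ y, 0 < f y) :
    0 < ∫ y, f y ∂μ := by
  rw [integral_pos_iff_support_of_nonneg (fun y => (hpos y).le) hf]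
  have : Function.support f = Set.univ := Set.eq_univ_of_forall fun y => (hpos y).ne'
  simp [this]

/-- The entropy of a positive function is at most its variance divided by its mean. -/
theorem phiEntropy_mul_log_le {Y : Type*} [MeasurableSpace Y] {μ : Measure Y}
    [IsProbabilityMeasure μ] {f : Y → ℝ} (hf : MemLp f 2 μ) (hpos : ∀ y, 0 < f y) :
    phiEntropy (fun u => u * Real.log u) μ f ≤ variance f μ / ∫ y, f y ∂μ := by
  have hi : Integrable f μ := hf.integrable (by norm_num)
  have hc : 0 < ∫ y, f y ∂μ := integral_pos_of_pos hi hpos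
  have hlog := integrable_mul_log hf hpos
  have hsq := hf.integrable_sq
  rw [variance_eq_sub hf, phiEntropy]
  set c := ∫ y, f y ∂μ with hcdef
  -- This is `log (f / c) ≤ f / c - 1`, multiplied by `f`.
  have h1 : ∫ y, (f y * Real.log (f y) - Real.log c * f y) ∂μ ≤ ∫ y, (f y ^ 2 / c - f y) ∂μ := by
    refine integral_mono (hlog.sub (hi.const_mul _)) ((hsq.div_const c).sub hi) fun y => ?_
    have h2 := Real.log_le_sub_one_of_pos (div_pos (hpos y) hc)
    rw [Real.log_div (hpos y).ne' hc.ne'] at h2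
    have h3 := mul_le_mul_of_nonneg_left h2 (hpos y).le
    have h4 : f y * (f y / c - 1) = f y ^ 2 / c - f y := by ring
    simp only
    linarith
  rw [integral_sub hlog (hi.const_mul _), integral_sub (hsq.div_const c) hi, integral_const_mul,
    integral_div, ← hcdef] at h1
  have h5 : (∫ y, f y ^ 2 ∂μ - c ^ 2) / c = (∫ y, f y ^ 2 ∂μ) / c - c := by
    field_simp
  have h6 : (∫ y, (f ^ 2) y ∂μ) = ∫ y, f y ^ 2 ∂μ := rfl
  rw [h6, h5]
  linarith

/-- Jensen's inequality for `(g, w) ↦ g² / w`. -/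
theorem ofReal_sq_div_avg_le [IsMarkovKernel m] {g w : X → ℝ} {Q : X → ℝ≥0∞} {x : X}
    (hg : Integrable g (m x)) (hw : Integrable w (m x)) (hpos : ∀ y, 0 < w y)
    (hQ : ∀ y, ENNReal.ofReal (g y ^ 2 / w y) ≤ Q y) :
    ENNReal.ofReal (avg m g x ^ 2 / avg m w x) ≤ averaging m Q x := by
  have hW : 0 < avg m w x := integral_pos_of_pos hw hpos
  -- For this slope the pointwise bound `2 c g - c² w ≤ g² / w` has left side averaging exactly to
  -- `(Mg)² / Mw`.
  set c := avg m g x / avg m w x with hc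
  have h1 : avg m g x ^ 2 / avg m w x = ∫ y, (2 * c * g y - c ^ 2 * w y) ∂m x := by
    rw [integral_sub (hg.const_mul _) (hw.const_mul _), integral_const_mul, integral_const_mul]
    change _ = 2 * c * avg m g x - c ^ 2 * avg m w x
    rw [hc]
    field_simp
    ring
  rw [h1]
  refine (ENNReal.ofReal_integral_le_lintegral_ofReal _ _).trans (lintegral_mono fun y => ?_)
  refine (ENNReal.ofReal_le_ofReal ?_).trans (hQ y)
  rw [le_div_iff₀ (hpos y)]
  nlinarith [sq_nonneg (c * w y - g y)]

end PhiEntropy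

/-! ### Self-adjointness under reversibility -/

section Reversible

variable {X : Type*} [MeasurableSpace X] {m : Kernel X X} {ν : Measure X}

theorem ProbabilityTheory.Kernel.IsReversible.map_swap_compProd [IsMarkovKernel m]
    [IsFiniteMeasure ν] (h : Kernel.IsReversible m ν) :
    (ν.compProd m).map Prod.swap = ν.compProd m := by
  have : IsFiniteMeasure ((ν.compProd m).map Prod.swap) :=
    Measure.isFiniteMeasure_map _ _
  refine Measure.ext_prod fun {A B} hA hB => ?_
  rw [Measure.map_apply measurable_swap (hA.prod hB), Set.preimage_swap_prod,
    Measure.compProd_apply_prod hB hA, Measure.compProd_apply_prod hA hB]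
  exact h hB hA

/-- Both sides integrate a product `u ⊗ v`, up to swapping coordinates, against `ν.compProd m`,
which is symmetric. -/
theorem ProbabilityTheory.Kernel.IsReversible.lintegral_mul_averaging [IsMarkovKernel m]
    [IsFiniteMeasure ν] (h : Kernel.IsReversible m ν) {u v : X → ℝ≥0∞} (hu : Measurable u)
    (hv : Measurable v) :
    ∫⁻ x, u x * averaging m v x ∂ν = ∫⁻ x, averaging m u x * v x ∂ν := by
  have h1 : ∀ u v : X → ℝ≥0∞, Measurable u → Measurable v →
      ∫⁻ x, u x * averaging m v x ∂ν = ∫⁻ p, u p.1 * v p.2 ∂(ν.compProd m) := by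
    intro u v hu hv
    rw [Measure.lintegral_compProd (by fun_prop)]
    refine lintegral_congr fun x => ?_
    simp only [averaging]
    rw [lintegral_const_mul _ hv]
  rw [h1 u v hu hv]
  simp only [mul_comm (averaging m u _)]
  rw [h1 v u hv hu]
  conv_rhs => rw [← h.map_swap_compProd]
  rw [MeasureTheory.lintegral_map (by fun_prop) measurable_swap]
  simp [mul_comm]

theorem ProbabilityTheory.Kernel.IsReversible.lintegral_mul_averaging_iterate [IsMarkovKernel m]
    [IsFiniteMeasure ν] (h : Kernel.IsReversible m ν) {u v : X → ℝ≥0∞} (hu : Measurable u)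
    (hv : Measurable v) (t : ℕ) :
    ∫⁻ x, u x * (averaging m)^[t] v x ∂ν = ∫⁻ x, (averaging m)^[t] u x * v x ∂ν := by
  induction t generalizing u with
  | zero => rfl
  | succ t ih =>
    rw [Function.iterate_succ_apply', h.lintegral_mul_averaging hu
      (measurable_averaging_iterate hv t),
      ih (u := averaging m u) (measurable_averaging_iterate hu 1),
      Function.iterate_succ_apply]

end Reversible

/-! ### Local entropy bounds and their summation -/

/-- The bound on the local entropies along the random walk. -/
noncomputable def localBound {X : Type*} [MetricSpace X] [MeasurableSpace X] (m : Kernel X X)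
    (κ : ℝ) (Q : X → ℝ≥0∞) (t : ℕ) (x : X) : ℝ≥0∞ :=
  ENNReal.ofReal (Real.exp (1 / 2)) * ENNReal.ofReal ((1 - κ / 2) ^ (2 * t)) *
    (maxVariance (m x) * (averaging m)^[t + 1] Q x)

theorem exp_half_le_two : Real.exp (1 / 2) ≤ 2 := by
  have h1 := Real.exp_one_lt_d9
  have h2 : Real.exp 1 = Real.exp (1 / 2) ^ 2 := by
    rw [← Real.exp_nat_mul]; norm_num
  rw [h2] at h1
  nlinarith [Real.exp_pos (1 / 2)]

namespace ContractiveWalk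

variable {X : Type*} [MetricSpace X] [SecondCountableTopology X] [MeasurableSpace X] [BorelSpace X]
  {m : Kernel X X} {ξ : X → X → Measure (X × X)} {κ l s : ℝ} {f g : X → ℝ}
  {ν : Measure X} [IsProbabilityMeasure ν]

theorem memLp_two_kernel (H : ContractiveWalk m ξ κ l s) (hg : GradBound l f g) (x : X) :
    MemLp f 2 (m x) := by
  have := H.markov
  obtain ⟨C, hC⟩ := H.exists_abs_le hg x
  refine MemLp.of_bound hg.continuous.aestronglyMeasurable C ?_
  filter_upwards [Measure.support_mem_ae (μ := m x)] with z hz using hC z hz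

theorem integrable_iterate_weight (H : ContractiveWalk m ξ κ l s) (hg : GradBound l f g) (t : ℕ)
    (x : X) : Integrable ((avg m)^[t] g) (m x) := by
  have hr : 0 < 1 - κ / 2 := by linarith [H.κ_le_one]
  have h1 := (H.integrable_weight (H.gradBound_iterate hg t) x).const_mul ((1 - κ / 2) ^ t)⁻¹
  exact h1.congr (ae_of_all _ fun y => inv_mul_cancel_left₀ (pow_pos hr t).ne' _)

theorem iterate_pos (H : ContractiveWalk m ξ κ l s) {w : X → ℝ}
    (hwi : ∀ t x, Integrable ((avg m)^[t] w) (m x)) (hpos : ∀ x, 0 < w x) (t : ℕ) (x : X) :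
    0 < (avg m)^[t] w x := by
  have := H.markov
  induction t generalizing x with
  | zero => exact hpos x
  | succ t ih =>
    rw [Function.iterate_succ_apply']
    exact integral_pos_of_pos (hwi t x) ih

theorem ofReal_iterate_sq_div_le (H : ContractiveWalk m ξ κ l s) (hg : GradBound l f g) {w : X → ℝ}
    (hwi : ∀ t x, Integrable ((avg m)^[t] w) (m x)) (hpos : ∀ x, 0 < w x) (t : ℕ) (x : X) :
    ENNReal.ofReal ((avg m)^[t] g x ^ 2 / (avg m)^[t] w x) ≤
      (averaging m)^[t] (fun y => ENNReal.ofReal (g y ^ 2 / w y)) x := by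
  have := H.markov
  induction t generalizing x with
  | zero => exact le_rfl
  | succ t ih =>
    rw [Function.iterate_succ_apply', Function.iterate_succ_apply', Function.iterate_succ_apply']
    exact ofReal_sq_div_avg_le (H.integrable_iterate_weight hg t x) (hwi t x)
      (H.iterate_pos hwi hpos t) ih

/-- The local Poincaré inequality for the iterated pair, followed by Jensen. The choice `w = 1`
serves the variance and `w = f` the entropy. -/
theorem evariance_mul_inv_le (H : ContractiveWalk m ξ κ l s) (hg : GradBound l f g) {w : X → ℝ}
    (hwi : ∀ t x, Integrable ((avg m)^[t] w) (m x)) (hpos : ∀ x, 0 < w x) (t : ℕ) (x : X) :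
    evariance ((avg m)^[t] f) (m x) * ENNReal.ofReal (((avg m)^[t + 1] w x)⁻¹) ≤
      localBound m κ (fun y => ENNReal.ofReal (g y ^ 2 / w y)) t x := by
  have h1 := H.evariance_le (H.gradBound_iterate hg t) x
  have h2 : avg m (fun x => (1 - κ / 2) ^ t * (avg m)^[t] g x) x =
      (1 - κ / 2) ^ t * (avg m)^[t + 1] g x := by
    rw [Function.iterate_succ_apply']
    exact integral_const_mul _ _
  have hr : 0 ≤ 1 - κ / 2 := by linarith [H.κ_le_one]
  rw [h2, mul_pow, ← mul_assoc, ← pow_mul, mul_comm t 2] at h1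
  have h3 := H.ofReal_iterate_sq_div_le hg hwi hpos (t + 1) x
  calc _ ≤ ENNReal.ofReal (Real.exp (1 / 2) * (1 - κ / 2) ^ (2 * t) * (avg m)^[t + 1] g x ^ 2) *
        maxVariance (m x) * ENNReal.ofReal (((avg m)^[t + 1] w x)⁻¹) := by gcongr
    _ = ENNReal.ofReal (Real.exp (1 / 2)) * ENNReal.ofReal ((1 - κ / 2) ^ (2 * t)) *
        (maxVariance (m x) *
          ENNReal.ofReal ((avg m)^[t + 1] g x ^ 2 / (avg m)^[t + 1] w x)) := by
        rw [ENNReal.ofReal_mul (by positivity), ENNReal.ofReal_mul (by positivity),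
          div_eq_mul_inv ((avg m)^[t + 1] g x ^ 2),
          ENNReal.ofReal_mul (p := (avg m)^[t + 1] g x ^ 2) (by positivity)]
        ring
    _ ≤ _ := by
        rw [localBound]
        gcongr

/-- The geometric series sums to `1 / (κ - κ² / 4)`, so the constant 4 works as soon as `e^{1/2} κ /
4 ≤ κ - κ² / 4`, which holds with room to spare for `κ ≤ 1`. -/
theorem tsum_lintegral_localBound_le (H : ContractiveWalk m ξ κ l s) (hν : Kernel.Invariant m ν)
    {Q : X → ℝ≥0∞} (hQ : Measurable Q) {C : ℝ≥0∞}
    (hC : ∀ x, ENNReal.ofReal (4 / κ) * maxVariance (m x) ≤ C) :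
    ∑' t, ∫⁻ x, localBound m κ Q t x ∂ν ≤ C * ∫⁻ x, Q x ∂ν := by
  have hκ := H.κ_pos
  have hκ1 := H.κ_le_one
  have hr : 0 ≤ 1 - κ / 2 := by linarith
  have hV : ∀ x, maxVariance (m x) ≤ ENNReal.ofReal (κ / 4) * C := by
    intro x
    calc maxVariance (m x) = ENNReal.ofReal (κ / 4) *
          (ENNReal.ofReal (4 / κ) * maxVariance (m x)) := by
          rw [← mul_assoc, ← ENNReal.ofReal_mul (by positivity)]
          have : κ / 4 * (4 / κ) = 1 := by field_simp
          rw [this]; simp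
      _ ≤ _ := by gcongr; exact hC x
  have hterm : ∀ t, ∫⁻ x, localBound m κ Q t x ∂ν ≤
      ENNReal.ofReal (((1 - κ / 2) ^ 2) ^ t) *
        (ENNReal.ofReal (Real.exp (1 / 2) * (κ / 4)) * (C * ∫⁻ x, Q x ∂ν)) := by
    intro t
    have hm := measurable_averaging_iterate (m := m) hQ (t + 1)
    calc ∫⁻ x, localBound m κ Q t x ∂ν ≤ ∫⁻ x, ENNReal.ofReal (Real.exp (1 / 2)) *
          ENNReal.ofReal ((1 - κ / 2) ^ (2 * t)) * (ENNReal.ofReal (κ / 4) * C) *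
          (averaging m)^[t + 1] Q x ∂ν := by
          refine lintegral_mono fun x => ?_
          rw [localBound, mul_assoc _ (ENNReal.ofReal (κ / 4) * C)]
          gcongr
          exact hV x
      _ = _ := by
          rw [lintegral_const_mul _ hm, hν.lintegral_averaging_iterate hQ,
            ENNReal.ofReal_mul (Real.exp_pos _).le, pow_mul]
          ring
  refine (ENNReal.tsum_le_tsum hterm).trans ?_
  have hr2 : (1 - κ / 2) ^ 2 < 1 := by nlinarith
  rw [ENNReal.tsum_mul_right, ← ENNReal.ofReal_tsum_of_nonneg (fun t => by positivity)
    (summable_geometric_of_lt_one (by positivity) hr2),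
    tsum_geometric_of_lt_one (by positivity) hr2, ← mul_assoc,
    ← ENNReal.ofReal_mul (by rw [inv_nonneg]; linarith)]
  refine mul_le_of_le_one_left zero_le ?_
  rw [ENNReal.ofReal_le_one, inv_mul_le_iff₀ (by linarith)]
  nlinarith [exp_half_le_two, Real.exp_pos (1 / 2)]

/-- Self-adjointness moves `M^{t+1}` from `Q` to the maximal variance; the factor 2 in `weightV`
absorbs `e^{1/2}`. -/
theorem tsum_lintegral_localBound_le_weightV (H : ContractiveWalk m ξ κ l s)
    (hrev : Kernel.IsReversible m ν) {Q : X → ℝ≥0∞} (hQ : Measurable Q) :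
    ∑' t, ∫⁻ x, localBound m κ Q t x ∂ν ≤ ∫⁻ x, weightV m κ x * Q x ∂ν := by
  have := H.markov
  have hV := H.measurable_maxVariance
  have hVQ : ∀ t : ℕ, Measurable fun x => maxVariance (m x) * (averaging m)^[t] Q x :=
    fun t => hV.mul (measurable_averaging_iterate hQ t)
  have hVQ' : ∀ t : ℕ, Measurable fun x =>
      (averaging m)^[t] (fun y => maxVariance (m y)) x * Q x :=
    fun t => (measurable_averaging_iterate hV t).mul hQ
  have hterm : ∀ t, ∫⁻ x, localBound m κ Q t x ∂ν =
      ∫⁻ x, ENNReal.ofReal (Real.exp (1 / 2)) * ENNReal.ofReal ((1 - κ / 2) ^ (2 * t)) *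
        ((averaging m)^[t + 1] (fun y => maxVariance (m y)) x * Q x) ∂ν := by
    intro t
    simp only [localBound]
    rw [lintegral_const_mul _ (hVQ _), lintegral_const_mul _ (hVQ' _),
      hrev.lintegral_mul_averaging_iterate hV hQ]
  simp only [hterm]
  rw [← lintegral_tsum fun t =>
    ((hVQ' (t + 1)).const_mul _).aemeasurable]
  refine lintegral_mono fun x => ?_
  rw [weightV, ← ENNReal.tsum_mul_left, ← ENNReal.tsum_mul_right]
  refine ENNReal.tsum_le_tsum fun t => ?_
  rw [← mul_assoc, ← mul_assoc]
  gcongr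
  · rw [show (2 : ℝ≥0∞) = ENNReal.ofReal 2 by simp]
    exact ENNReal.ofReal_le_ofReal exp_half_le_two
  · exact averaging_iterate_mono (fun y => H.maxVariance_le y) _ x

theorem evariance_le_tsum (H : ContractiveWalk m ξ κ l s) (hν : Kernel.Invariant m ν)
    (hg : GradBound l f g) :
    evariance f ν ≤
      ∑' t, ∫⁻ x, localBound m κ (fun y => ENNReal.ofReal (g y ^ 2)) t x ∂ν := by
  have := H.markov
  have hL := H.memLp_two hν hg
  rw [← ofReal_variance hL, ← phiEntropy_sq hL]
  have hLt : ∀ t : ℕ, MemLp ((avg m)^[t] f) 2 ν := fun t =>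
    H.memLp_two hν (H.gradBound_iterate hg t)
  refine phiEntropy_le_tsum hν (fun t => (hLt t).integrable (by norm_num))
    (fun t => (hLt t).integrable_sq) (fun t x => ?_) ?_
  · have hm := H.memLp_two_kernel (H.gradBound_iterate hg t) x
    rw [phiEntropy_sq hm, ofReal_variance hm]
    have hone : ∀ t : ℕ, (avg m)^[t] (fun _ => (1 : ℝ)) = fun _ => 1 := fun t =>
      Function.iterate_fixed (by funext x; simp [avg]) t
    have h1 := H.evariance_mul_inv_le hg (w := fun _ => 1)
      (fun t x => by rw [hone]; exact integrable_const _) (fun _ => one_pos) t x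
    simpa [hone] using h1
  · have h1 := ENNReal.tendsto_ofReal (H.tendsto_variance hν hg)
    simpa [phiEntropy_sq (hLt _)] using h1

theorem entropy_le_tsum (H : ContractiveWalk m ξ κ l s) (hν : Kernel.Invariant m ν)
    (hg : GradBound l f g) (hpos : ∀ x, 0 < f x) :
    entropy ν f ≤
      ∑' t, ∫⁻ x, localBound m κ (fun y => ENNReal.ofReal (g y ^ 2 / f y)) t x ∂ν := by
  have := H.markov
  have hL := H.memLp_two hν hg
  have hLt : ∀ t : ℕ, MemLp ((avg m)^[t] f) 2 ν := fun t =>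
    H.memLp_two hν (H.gradBound_iterate hg t)
  have hit : ∀ t x, Integrable ((avg m)^[t] f) (m x) := fun t x =>
    H.integrable (H.gradBound_iterate hg t) x
  have hpt := H.iterate_pos hit hpos
  have hi : Integrable f ν := hL.integrable (by norm_num)
  rw [entropy, if_pos ⟨hi, integrable_mul_log hL hpos⟩]
  refine phiEntropy_le_tsum (Φ := fun u => u * Real.log u) hν
    (fun t => (hLt t).integrable (by norm_num))
    (fun t => integrable_mul_log (hLt t) (hpt t)) (fun t x => ?_) ?_
  · have hm := H.memLp_two_kernel (H.gradBound_iterate hg t) x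
    refine le_trans ?_ (H.evariance_mul_inv_le hg hit hpos t x)
    refine (ENNReal.ofReal_le_ofReal (phiEntropy_mul_log_le hm (hpt t))).trans (le_of_eq ?_)
    rw [div_eq_mul_inv, ENNReal.ofReal_mul (variance_nonneg _ _), ofReal_variance hm,
      Function.iterate_succ_apply']
    rfl
  -- The mean of `M^t f` stays equal to `∫ f dν > 0`, so entropy decays along with variance.
  · have h1 := ENNReal.tendsto_ofReal ((H.tendsto_variance hν hg).div_const (∫ x, f x ∂ν))
    rw [zero_div, ENNReal.ofReal_zero] at h1
    refine tendsto_of_tendsto_of_tendsto_of_le_of_le tendsto_const_nhds h1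
      (fun t => zero_le) (fun t => ENNReal.ofReal_le_ofReal ?_)
    have h2 := phiEntropy_mul_log_le (hLt t) (hpt t)
    rwa [(integral_avg_iterate hν hi t).2] at h2

end ContractiveWalk

/-! ### The range gradient as a gradient bound -/

section RangeGrad

variable {X : Type*} [MetricSpace X] {l : ℝ} {f : X → ℝ}

theorem le_toReal_rangeGrad (hf : ∀ x, rangeGrad l f x < ∞) (x : X) {y y' : X} (hy : y ≠ y') :
    |f y - f y'| / dist y y' * Real.exp (-l * dist x y - l * dist x y') ≤
      (rangeGrad l f x).toReal := by
  rw [← ENNReal.ofReal_le_iff_le_toReal (hf x).ne, ENNReal.ofReal_mul (by positivity),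
    ENNReal.ofReal_div_of_pos (dist_pos.2 hy), ← edist_dist, ← Real.dist_eq, ← edist_dist]
  exact le_iSup₂_of_le y y' (le_iSup_of_le hy le_rfl)

/-- Moving the base point changes each of the two distances in the exponent by at most `dist z z'`,
hence the rate `2 * l`. -/
theorem rangeGrad_le (hl : 0 < l) (z z' : X) :
    rangeGrad l f z ≤ ENNReal.ofReal (Real.exp (2 * l * dist z z')) * rangeGrad l f z' := by
  refine iSup₂_le fun y y' => iSup_le fun hy => ?_
  have h1 : edist (f y) (f y') / edist y y' *
      ENNReal.ofReal (Real.exp (-l * dist z' y - l * dist z' y')) ≤ rangeGrad l f z' :=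
    le_iSup₂_of_le y y' (le_iSup_of_le hy le_rfl)
  have h2 : Real.exp (-l * dist z y - l * dist z y') ≤ Real.exp (2 * l * dist z z') *
      Real.exp (-l * dist z' y - l * dist z' y') := by
    rw [← Real.exp_add, Real.exp_le_exp]
    have h3 := dist_triangle z' z y
    have h4 := dist_triangle z' z y'
    rw [dist_comm z' z] at h3 h4
    nlinarith
  calc _ ≤ edist (f y) (f y') / edist y y' * (ENNReal.ofReal (Real.exp (2 * l * dist z z')) *
        ENNReal.ofReal (Real.exp (-l * dist z' y - l * dist z' y'))) := by
        rw [← ENNReal.ofReal_mul (Real.exp_pos _).le]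
        gcongr
    _ = ENNReal.ofReal (Real.exp (2 * l * dist z z')) * (edist (f y) (f y') / edist y y' *
        ENNReal.ofReal (Real.exp (-l * dist z' y - l * dist z' y'))) := by ring
    _ ≤ _ := by gcongr

/-- The increment bound is the term of the supremum in which the base point is itself one of the two
points. -/
theorem gradBound_rangeGrad (hl : 0 < l) (hf : ∀ x, rangeGrad l f x < ∞) :
    GradBound l f fun x => (rangeGrad l f x).toReal := by
  refine ⟨fun z => ENNReal.toReal_nonneg, fun z z' => ?_, fun z z' => ?_⟩
  · rcases eq_or_ne z z' with rfl | hz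
    · simp
    have h1 := le_toReal_rangeGrad hf z hz
    have hd := dist_pos.2 hz
    rw [dist_self, mul_zero, zero_sub, Real.exp_neg, ← div_eq_mul_inv,
      div_le_iff₀ (Real.exp_pos _), div_le_iff₀ hd] at h1
    linarith
  · have h1 := ENNReal.toReal_mono (ENNReal.mul_ne_top ENNReal.ofReal_ne_top (hf z').ne)
      (rangeGrad_le (f := f) hl z z')
    rwa [ENNReal.toReal_mul, ENNReal.toReal_ofReal (Real.exp_pos _).le] at h1

end RangeGrad

/-! ### From curvature and range to a contractive walk -/

section Construction

variable {X : Type*} [MetricSpace X] [SecondCountableTopology X] [MeasurableSpace X] [BorelSpace X]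
  {m : Kernel X X} {ξ : X → X → Measure (X × X)} {κ l : ℝ}

/-- Since `e^ρ (1 - ρ) ≤ 1` and `u + 1/2 ≤ (1 - ρ)(1 + u)`, one gets `e^ρ (u + 1/2) ≤ 1 + u`. It is
used with `ρ = 12 l σ_∞` and `u = U`. -/
theorem exp_mul_le_of_small {ρ u : ℝ} (hu : 0 ≤ u) (h : ρ * (1 + u) ≤ 1 / 2) :
    (Real.exp ρ - 1) * u ≤ 1 - Real.exp ρ / 2 := by
  have h1 : Real.exp ρ * (1 - ρ) ≤ 1 := by
    have h2 := Real.add_one_le_exp (-ρ)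
    have h3 : Real.exp ρ * Real.exp (-ρ) = 1 := by rw [← Real.exp_add]; simp
    nlinarith [Real.exp_pos ρ]
  have h4 : Real.exp ρ * (u + 1 / 2) ≤ Real.exp ρ * ((1 - ρ) * (1 + u)) :=
    mul_le_mul_of_nonneg_left (by linarith) (Real.exp_pos ρ).le
  nlinarith

theorem IsOptimalCoupling.integral_dist {ζ : Measure (X × X)} {μ μ' : Measure X}
    (h : IsOptimalCoupling ζ μ μ') :
    ∫ p, dist p.1 p.2 ∂ζ = (transportDist μ μ').toReal := by
  rw [← h.2, integral_eq_lintegral_of_nonneg_ae (ae_of_all _ fun p => dist_nonneg)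
    (by fun_prop)]
  simp only [transportCost, edist_dist]

theorem contractiveWalk_of_curvature [Nontrivial X] (hm : IsRandomWalk m) (hκ : 0 < κ)
    (hcurv : ∀ x y : X, x ≠ y → κ ≤ ricciCurv m x y)
    (hξ : ∀ x y : X, IsOptimalCoupling (ξ x y) (m x) (m y)) (hl : 0 < l)
    (hlU : ENNReal.ofReal l ≤ 1 / (24 * spreadInfty m * (1 + unstability m ξ))) :
    ContractiveWalk m ξ κ l (spreadInfty m).toReal := by
  have hden : 24 * spreadInfty m * (1 + unstability m ξ) ≠ ∞ := by
    intro h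
    rw [h] at hlU
    simp at hlU
    linarith
  have hs : spreadInfty m ≠ ∞ := by
    intro h
    rw [h] at hden
    simp at hden
  -- When `σ_∞ = 0` the product is `0` even if `U = ∞`, so nothing is known about `U`; that case is
  -- treated apart, with exponential factor 1.
  have hsU : spreadInfty m ≠ 0 → unstability m ξ ≠ ∞ := by
    intro h0 h
    rw [h] at hden
    simp [h0] at hden
  have hs0 : 0 ≤ (spreadInfty m).toReal := ENNReal.toReal_nonneg
  have hsmall : spreadInfty m ≠ 0 → 12 * l * (spreadInfty m).toReal *
      (1 + (unstability m ξ).toReal) ≤ 1 / 2 := by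
    intro h0
    have hne : 24 * spreadInfty m * (1 + unstability m ξ) ≠ 0 := by simp [h0]
    rw [ENNReal.le_div_iff_mul_le (Or.inl hne) (Or.inl hden)] at hlU
    have h1 := ENNReal.toReal_mono ENNReal.one_ne_top hlU
    rw [ENNReal.toReal_mul, ENNReal.toReal_mul, ENNReal.toReal_mul,
      ENNReal.toReal_add ENNReal.one_ne_top (hsU h0), ENNReal.toReal_ofReal hl.le] at h1
    norm_num at h1
    linarith
  have hu0 : 0 ≤ (unstability m ξ).toReal := ENNReal.toReal_nonneg
  have hD : ∀ x y, x ≠ y → ricciCurv m x y * dist x y =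
      dist x y - ∫ p, dist p.1 p.2 ∂ξ x y := by
    intro x y hxy
    have hd := dist_pos.2 hxy
    rw [(hξ x y).integral_dist, ricciCurv]
    field_simp
  -- Curvature never exceeds 1, but a pair of distinct points is needed to compare it with `κ`.
  have hκ1 : κ ≤ 1 := by
    obtain ⟨x, y, hxy⟩ := exists_pair_ne X
    refine (hcurv x y hxy).trans (sub_le_self _ ?_)
    positivity
  have hcu : ∀ x y, x ≠ y → ∫ p, dist p.1 p.2 ∂ξ x y ≤ (1 - κ) * dist x y := by
    intro x y hxy
    have h1 := mul_le_mul_of_nonneg_right (hcurv x y hxy) (dist_nonneg (x := x) (y := y))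
    rw [hD x y hxy] at h1
    linarith
  refine ⟨hm.isMarkovKernel, hκ, hκ1, hl, hs0, ?_, fun x y => (hξ x y).1, ?_, hcu, ?_⟩
  · rcases eq_or_ne (spreadInfty m) 0 with h0 | h0
    · simp [h0]
    · have h1 := hsmall h0
      have h2 : 0 ≤ 12 * l * (spreadInfty m).toReal := by positivity
      nlinarith
  · intro x z hz w hw
    have h1 : Metric.ediam (m x).support / 2 ≤ spreadInfty m :=
      le_iSup (fun x => Metric.ediam (m x).support / 2) x
    rw [ENNReal.div_le_iff (by simp) (by simp)] at h1
    have h2 := (Metric.edist_le_ediam_of_mem hz hw).trans h1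
    have h3 := ENNReal.toReal_mono (ENNReal.mul_ne_top hs (by simp)) h2
    rw [ENNReal.toReal_mul, edist_dist, ENNReal.toReal_ofReal dist_nonneg] at h3
    norm_num at h3
    linarith
  · intro x y hxy
    have hd := dist_pos.2 hxy
    have hδ : 0 ≤ dist x y - ∫ p, dist p.1 p.2 ∂ξ x y := by
      have := hcu x y hxy
      have : 0 ≤ κ * dist x y := by positivity
      linarith
    rcases eq_or_ne (spreadInfty m) 0 with h0 | h0
    · simp only [h0, ENNReal.toReal_zero, mul_zero, Real.exp_zero, sub_self, zero_mul]
      nlinarith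
    have hric : 0 < ricciCurv m x y := hκ.trans_le (hcurv x y hxy)
    have hU := hsU h0
    have hP : ∫ p, max (dist p.1 p.2 - dist x y) 0 ∂ξ x y ≤
        (unstability m ξ).toReal * (dist x y - ∫ p, dist p.1 p.2 ∂ξ x y) := by
      have h1 : kappaMinus (ξ x y) x y / ENNReal.ofReal (ricciCurv m x y) ≤ unstability m ξ :=
        le_iSup₂_of_le x y (le_iSup_of_le hxy le_rfl)
      rw [ENNReal.div_le_iff (by simpa using hric) (by simp), kappaMinus,
        ENNReal.div_le_iff (by simpa using hxy) (by simp)] at h1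
      have h2 := ENNReal.toReal_mono
        (ENNReal.mul_ne_top (ENNReal.mul_ne_top hU (by simp)) (by simp)) h1
      rw [ENNReal.toReal_mul, ENNReal.toReal_mul, ENNReal.toReal_ofReal hric.le, edist_dist,
        ENNReal.toReal_ofReal dist_nonneg, mul_assoc, hD x y hxy] at h2
      have h3 : ∫ p, max (dist p.1 p.2 - dist x y) 0 ∂ξ x y =
          (∫⁻ p, ENNReal.ofReal (max (dist p.1 p.2 - dist x y) 0) ∂ξ x y).toReal :=
        integral_eq_lintegral_of_nonneg_ae (ae_of_all _ fun p => le_max_right _ _) (by fun_prop)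
      rw [h3]
      simpa [ENNReal.ofReal_max] using h2
    have hE : 0 ≤ Real.exp (12 * l * (spreadInfty m).toReal) - 1 :=
      sub_nonneg.2 (Real.one_le_exp (by positivity))
    calc _ ≤ (Real.exp (12 * l * (spreadInfty m).toReal) - 1) *
          ((unstability m ξ).toReal * (dist x y - ∫ p, dist p.1 p.2 ∂ξ x y)) :=
          mul_le_mul_of_nonneg_left hP hE
      _ ≤ _ := by
          rw [← mul_assoc]
          exact mul_le_mul_of_nonneg_right (exp_mul_le_of_small hu0 (hsmall h0)) hδ

end Construction

/-! ### One-point spaces -/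

section Degenerate

variable {X : Type*} [MeasurableSpace X] [Subsingleton X] {ν : Measure X} [IsProbabilityMeasure ν]

theorem exists_eq_const_of_subsingleton (ν : Measure X) [IsProbabilityMeasure ν] (f : X → ℝ) :
    ∃ c, f = fun _ => c := by
  obtain ⟨o⟩ := nonempty_of_isProbabilityMeasure ν
  exact ⟨f o, funext fun x => by rw [Subsingleton.elim x o]⟩

theorem evariance_of_subsingleton (f : X → ℝ) : evariance f ν = 0 := by
  obtain ⟨c, rfl⟩ := exists_eq_const_of_subsingleton ν f
  simp [evariance]

theorem entropy_of_subsingleton (f : X → ℝ) : entropy ν f = 0 := by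
  obtain ⟨c, rfl⟩ := exists_eq_const_of_subsingleton ν f
  simp [entropy]

end Degenerate

/-! ### The functional inequalities -/

theorem theorem40 {X : Type*} [MetricSpace X] [CompleteSpace X] [SecondCountableTopology X]
    [MeasurableSpace X] [BorelSpace X]
    (m : Kernel X X) (hm : IsRandomWalk m)
    (κ : ℝ) (hκ : 0 < κ) (hcurv : ∀ x y : X, x ≠ y → κ ≤ ricciCurv m x y)
    (ξ : X → X → Measure (X × X)) (hξ : ∀ x y : X, IsOptimalCoupling (ξ x y) (m x) (m y))
    (l : ℝ) (hl : 0 < l)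
    (hlU : ENNReal.ofReal l ≤ 1 / (24 * spreadInfty m * (1 + unstability m ξ)))
    (ν : Measure X) [IsProbabilityMeasure ν] (hν : Kernel.Invariant m ν)
    (f : X → ℝ) (hf : ∀ x, rangeGrad l f x < ∞) :
    evariance f ν ≤ (⨆ x, 4 * spread m x ^ 2 / (ENNReal.ofReal κ * localDim m x)) *
        ∫⁻ x, rangeGrad l f x ^ 2 ∂ν ∧
    ((∀ x, 0 < f x) →
      entropy ν f ≤ (⨆ x, 4 * spread m x ^ 2 / (ENNReal.ofReal κ * localDim m x)) *
        ∫⁻ x, rangeGrad l f x ^ 2 / ENNReal.ofReal (f x) ∂ν) ∧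
    (Kernel.IsReversible m ν →
      evariance f ν ≤ ∫⁻ x, weightV m κ x * rangeGrad l f x ^ 2 ∂ν ∧
      ((∀ x, 0 < f x) →
        entropy ν f ≤
          ∫⁻ x, weightV m κ x * (rangeGrad l f x ^ 2 / ENNReal.ofReal (f x)) ∂ν)) := by
  -- On a one-point space the curvature hypothesis is vacuous and `κ` may exceed 1, but variance and
  -- entropy vanish.
  rcases subsingleton_or_nontrivial X with hX | hX
  · simp only [evariance_of_subsingleton, entropy_of_subsingleton]
    exact ⟨zero_le, fun _ => zero_le, fun _ => ⟨zero_le, fun _ => zero_le⟩⟩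
  have H := contractiveWalk_of_curvature hm hκ hcurv hξ hl hlU
  have hg := gradBound_rangeGrad hl hf
  have hgc := hg.continuous_weight.measurable
  have hfc := hg.continuous.measurable
  have hsq : ∀ x, ENNReal.ofReal ((rangeGrad l f x).toReal ^ 2) = rangeGrad l f x ^ 2 := fun x => by
    rw [ENNReal.ofReal_pow ENNReal.toReal_nonneg, ENNReal.ofReal_toReal (hf x).ne]
  have hdiv : (∀ x, 0 < f x) → ∀ x, ENNReal.ofReal ((rangeGrad l f x).toReal ^ 2 / f x) =
      rangeGrad l f x ^ 2 / ENNReal.ofReal (f x) := fun hpos x => by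
    rw [ENNReal.ofReal_div_of_pos (hpos x), hsq]
  have hC : ∀ x, ENNReal.ofReal (4 / κ) * maxVariance (m x) ≤
      ⨆ x, 4 * spread m x ^ 2 / (ENNReal.ofReal κ * localDim m x) := fun x => by
    refine le_iSup_of_le x ?_
    have h1 := H.maxVariance_le x
    have hκ0 : ENNReal.ofReal κ ≠ 0 := by simpa using hκ
    calc ENNReal.ofReal (4 / κ) * maxVariance (m x) ≤
          ENNReal.ofReal (4 / κ) * (spread m x ^ 2 / localDim m x) := by gcongr
      _ = _ := by
          rw [ENNReal.ofReal_div_of_pos hκ, div_eq_mul_inv, div_eq_mul_inv, div_eq_mul_inv,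
            ENNReal.mul_inv (Or.inl hκ0) (Or.inl ENNReal.ofReal_ne_top)]
          rw [show ENNReal.ofReal 4 = 4 by simp]
          ring
  have hvar := H.evariance_le_tsum hν hg
  simp only [hsq] at hvar
  have hmeas : Measurable fun x => rangeGrad l f x ^ 2 := by
    simp only [← hsq]
    exact (hgc.pow_const 2).ennreal_ofReal
  have hmeas' : Measurable fun x => rangeGrad l f x ^ 2 / ENNReal.ofReal (f x) :=
    hmeas.div hfc.ennreal_ofReal
  refine ⟨hvar.trans (H.tsum_lintegral_localBound_le hν hmeas hC), fun hpos => ?_,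
    fun hrev => ⟨hvar.trans (H.tsum_lintegral_localBound_le_weightV hrev hmeas), fun hpos => ?_⟩⟩
  · have hent := H.entropy_le_tsum hν hg hpos
    simp only [hdiv hpos] at hent
    exact hent.trans (H.tsum_lintegral_localBound_le hν hmeas' hC)
  · have hent := H.entropy_le_tsum hν hg hpos
    simp only [hdiv hpos] at hent
    exact hent.trans (H.tsum_lintegral_localBound_le_weightV hrev hmeas')
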